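/- **Definitions.** A category $I$ is *finitely generated* if there are finitely many arrows whose closure under composition consists of all arrows of $I$ (including the identities, so $I$ has finitely many objects). A *diagram* of shape $I$ in a category $C$ is a functor $F : I \to C$; a *cocone* over it is an object $X$ with morphisms $f_i : F(i) \to X$ such that $f_i = f_j \circ F(a)$ for every $a : i \to j$. $C$ has the *AP* if every diagram of shape $\bullet \leftarrow \bullet \to \bullet$ in $C$ has a cocone, and the *JEP* if every diagram of finite discrete shape (including the empty shape) in $C$ has a cocone. $\mathbf{Inj}$ is the category of sets and injections. A category is *connected* if it is nonempty and any two objects are joined by a zigzag of morphisms; it is *simply-connected* if its fundamental groupoid (the groupoid freely generated by the category) has at most one morphism between any two objects (connectedness is not required). An *inverse category* is a category in which every morphism $f : X \to Y$ has a unique pseudoinverse $f^{-1} : Y \to X$, i.e. one with $f f^{-1} f = f$ and $f^{-1} f f^{-1} = f^{-1}$. Let $L(I)$ be the inverse category freely generated by $I$ such that every arrow of $I$ becomes monic: there is a functor $\eta : I \to L(I)$ with $\eta(a)^{-1} \circ \eta(a) = 1$ for all arrows $a$, and every functor $F$ from $I$ to an inverse category with $F(a)^{-1} \circ F(a) = 1$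 for all $a$ factors uniquely through $\eta$. $I$ is *upward-simply-connected* if every endomorphism $f$ in $L(I)$ is idempotent, $f \circ f = f$. Finite *tree-like* posets are defined inductively: if $n \ge 0$, $K_1, \dots, K_n$ are finite tree-like posets and $U_k \subseteq K_k$ is a connected (hence nonempty) upward-closed subset for each $k$, then the disjoint union of the $K_k$ together with one new point lying below exactly the elements of $U_1 \cup \dots \cup U_n$ (and itself) is tree-like; the class is closed under isomorphism. A finite poset is *forest-like* if it is a finite disjoint union of tree-like posets. A poset is regarded as a category with a unique arrow $x \to y$ iff $x \le y$. **Theorem.** Let $I$ be a finitely generated category. The following are equivalent: (i) every $I$-shaped diagram in a category with the AP and the JEP has a cocone; (ii) every $I$-shaped diagram in $\mathbf{Inj}$ has a cocone; (iii) $I$ is upward-simply-connected. If $I$ is finite (finitely many objects and arrows), then (ii) is equivalent to its restriction to diagrams $F : I \to \mathbf{Inj}$ all of whose values $F(i)$ are finite sets. If $I$ is a finite poset, then (i), (ii), (iii) are further equivalent to: (iv) every upward-closed subset of $I$, with the induced order, is simply-connected; (v) $I$ is forest-like. Similarly, for a finitely generated category $I$, every $I$-shaped diagram in a category with the AP has a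 cocone if and only if $I$ is connected and (ii) holds, if and only if $I$ is connected and (iii) holds; and if $I$ is a finite poset, this is also equivalent to $I$ being connected and satisfying (iv), and to $I$ being connected and satisfying (v). -/

import Mathlib

open CategoryTheory CategoryTheory.Limits

universe u v u₁ v₁ w

namespace AmalgamableShapes

/-! ### Finite generation, cocones, AP and JEP -/

/-- `I` is finitely generated: there are finitely many arrows whose closure under (binary)
composition consists of all arrows. Identities have to be obtained as well, so such an `I` has
finitely many objects. -/
def IsFinitelyGenerated (I : Type u) [Category.{v} I] : Prop :=
  ∃ W : MorphismProperty I, W.toSet.Finite ∧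
    ∀ W' : MorphismProperty I, W'.IsStableUnderComposition → W ≤ W' → W' = ⊤

/-- Every `J`-shaped diagram in `C` has a cocone. -/
def EveryDiagramHasCocone (J : Type u) [Category.{v} J] (C : Type u₁) [Category.{v₁} C] : Prop :=
  ∀ F : J ⥤ C, Nonempty (Cocone F)

/-- The amalgamation property: every diagram of shape `• ← • → •` has a cocone. -/
def AmalgamationProperty (C : Type u₁) [Category.{v₁} C] : Prop :=
  EveryDiagramHasCocone WalkingSpan C

/-- The joint embedding property: every diagram of finite discrete shape (including the empty
shape) has a cocone. -/
def JointEmbeddingProperty (C : Type u₁) [Category.{v₁} C] : Prop :=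
  ∀ n : ℕ, EveryDiagramHasCocone (Discrete (Fin n)) C

/-! ### Sets and injections -/

/-- The objects of the category of sets and injections. -/
structure Inj : Type (w + 1) where
  /-- The underlying set. -/
  carrier : Type w

instance : Category.{w} Inj.{w} where
  Hom X Y := X.carrier ↪ Y.carrier
  id X := Function.Embedding.refl X.carrier
  comp f g := f.trans g

/-! ### Simply-connected categories -/

/-- `I` is simply-connected: its fundamental groupoid (the free groupoid on the category `I`) has
at most one morphism between any two objects. Connectedness is not required. -/
def IsSimplyConnectedCategory (I : Type u) [Category.{v} I] : Prop :=
  Quiver.IsThin (FreeGroupoid I)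

/-! ### Inverse categories -/

section Inverse

variable {C : Type u₁} [Category.{v₁} C]

/-- `g` is a pseudoinverse of `f`. -/
def IsPseudoinverse {X Y : C} (f : X ⟶ Y) (g : Y ⟶ X) : Prop :=
  f ≫ g ≫ f = f ∧ g ≫ f ≫ g = g

variable (C) in
/-- An inverse category: every morphism has a unique pseudoinverse. -/
def IsInverseCategory : Prop :=
  ∀ (X Y : C) (f : X ⟶ Y), ∃! g : Y ⟶ X, IsPseudoinverse f g

variable (C) in
/-- An idempotent category: every endomorphism is idempotent. -/
def IsIdempotentCategory : Prop :=
  ∀ (X : C) (f : X ⟶ X), f ≫ f = f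

theorem IsPseudoinverse.symm {X Y : C} {f : X ⟶ Y} {g : Y ⟶ X} (h : IsPseudoinverse f g) :
    IsPseudoinverse g f := ⟨h.2, h.1⟩

theorem IsInverseCategory.comp_idem (hC : IsInverseCategory C) {X : C} {e f : X ⟶ X}
    (he : e ≫ e = e) (hf : f ≫ f = f) : (e ≫ f) ≫ (e ≫ f) = e ≫ f := by
  obtain ⟨x, hx, -⟩ := hC X X (e ≫ f)
  have h1 : e ≫ f ≫ x ≫ e ≫ f = e ≫ f := by simpa using hx.1
  have h2 : x ≫ e ≫ f ≫ x = x := by simpa using hx.2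
  have he' : ∀ {Z : C} (k : X ⟶ Z), e ≫ e ≫ k = e ≫ k := fun k => by
    rw [← Category.assoc, he]
  have hf' : ∀ {Z : C} (k : X ⟶ Z), f ≫ f ≫ k = f ≫ k := fun k => by
    rw [← Category.assoc, hf]
  have h2' : ∀ {Z : C} (k : X ⟶ Z), x ≫ e ≫ f ≫ x ≫ k = x ≫ k := fun k => by
    conv_rhs => rw [← h2]
    simp
  have hy : IsPseudoinverse (e ≫ f) (f ≫ x ≫ e) := by
    constructor
    · simp only [Category.assoc, he', hf', h1]
    · simp only [Category.assoc, he', hf', h2']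
  have hyy : (f ≫ x ≫ e) ≫ (f ≫ x ≫ e) = f ≫ x ≫ e := by
    simp only [Category.assoc, h2']
  have hself : IsPseudoinverse (f ≫ x ≫ e) (f ≫ x ≫ e) := by
    constructor <;> rw [hyy, hyy]
  have key : e ≫ f = f ≫ x ≫ e := (hC X X _).unique hy.symm hself
  rw [key, hyy]

theorem IsInverseCategory.idem_comm (hC : IsInverseCategory C) {X : C} {e f : X ⟶ X}
    (he : e ≫ e = e) (hf : f ≫ f = f) : e ≫ f = f ≫ e := by
  have h1 := hC.comp_idem he hf
  have h2 := hC.comp_idem hf he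
  have he' : ∀ {Z : C} (k : X ⟶ Z), e ≫ e ≫ k = e ≫ k := fun k => by
    rw [← Category.assoc, he]
  have hf' : ∀ {Z : C} (k : X ⟶ Z), f ≫ f ≫ k = f ≫ k := fun k => by
    rw [← Category.assoc, hf]
  refine (hC X X (e ≫ f)).unique ⟨?_, ?_⟩ ⟨?_, ?_⟩
  · rw [h1, h1]
  · rw [h1, h1]
  · simpa only [Category.assoc, he', hf'] using h1
  · simpa only [Category.assoc, he', hf'] using h2

/-- A category in which morphisms have pseudoinverses and idempotents commute is inverse. -/
theorem isInverseCategory_of_idem_comm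
    (h1 : ∀ (X Y : C) (f : X ⟶ Y), ∃ g : Y ⟶ X, IsPseudoinverse f g)
    (h2 : ∀ (X : C) (e f : X ⟶ X), e ≫ e = e → f ≫ f = f → e ≫ f = f ≫ e) :
    IsInverseCategory C := by
  intro X Y f
  obtain ⟨g, hg⟩ := h1 X Y f
  refine ⟨g, hg, fun k hk => ?_⟩
  have idem : ∀ {A B : C} {a : A ⟶ B} {b : B ⟶ A}, IsPseudoinverse a b →
      (a ≫ b) ≫ (a ≫ b) = a ≫ b := fun {A B a b} h => by
    rw [Category.assoc, h.2]
  have e1 : g = g ≫ f ≫ k := by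
    calc g = g ≫ (f ≫ k ≫ f) ≫ g := by rw [hk.1, hg.2]
      _ = g ≫ (f ≫ k) ≫ (f ≫ g) := by simp
      _ = g ≫ (f ≫ g) ≫ (f ≫ k) := by rw [h2 _ _ _ (idem hk) (idem hg)]
      _ = (g ≫ f ≫ g) ≫ f ≫ k := by simp
      _ = g ≫ f ≫ k := by rw [hg.2]
  have e2 : k = g ≫ f ≫ k := by
    calc k = (k ≫ (f ≫ g ≫ f)) ≫ k := by rw [hg.1, Category.assoc, hk.2]
      _ = ((k ≫ f) ≫ (g ≫ f)) ≫ k := by simp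
      _ = ((g ≫ f) ≫ (k ≫ f)) ≫ k := by rw [h2 _ _ _ (idem hk.symm) (idem hg.symm)]
      _ = g ≫ f ≫ (k ≫ f ≫ k) := by simp
      _ = g ≫ f ≫ k := by rw [hk.2]
  rw [e1, ← e2]

/-- The pseudoinverse of a morphism in an inverse category. -/
noncomputable def IsInverseCategory.pinv (hC : IsInverseCategory C) {X Y : C} (f : X ⟶ Y) :
    Y ⟶ X := (hC X Y f).choose

theorem IsInverseCategory.pinv_spec (hC : IsInverseCategory C) {X Y : C} (f : X ⟶ Y) :
    IsPseudoinverse f (hC.pinv f) := (hC X Y f).choose_spec.1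

end Inverse

/-! ### The left fundamental inverse category `L(I)` -/

section LeftFundamental

variable (I : Type u) [Category.{v} I]

/-- Formal composites of arrows of `I` and formal pseudoinverses (in diagrammatic order). -/
inductive PreHom : I → I → Type (max u v)
  | of {X Y : I} (f : X ⟶ Y) : PreHom X Y
  | comp {X Y Z : I} (p : PreHom X Y) (q : PreHom Y Z) : PreHom X Z
  | inv {X Y : I} (p : PreHom X Y) : PreHom Y X

variable {I}

/-- The least congruence making the formal composites into an inverse category, in which the arrows
of `I` compose as in `I` and satisfy `i⁻¹ ∘ i = 1`, i.e. become monic. (An involution with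
`p p⁻¹ p = p` such that the idempotents `p p⁻¹` commute is the usual equational description of
pseudoinverses.) -/
inductive PreHomRel : ∀ {X Y : I}, PreHom I X Y → PreHom I X Y → Prop
  | refl {X Y : I} (p : PreHom I X Y) : PreHomRel p p
  | symm {X Y : I} {p q : PreHom I X Y} : PreHomRel p q → PreHomRel q p
  | trans {X Y : I} {p q r : PreHom I X Y} : PreHomRel p q → PreHomRel q r → PreHomRel p r
  | comp_congr {X Y Z : I} {p p' : PreHom I X Y} {q q' : PreHom I Y Z} :
      PreHomRel p p' → PreHomRel q q' → PreHomRel (p.comp q) (p'.comp q')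
  | inv_congr {X Y : I} {p p' : PreHom I X Y} : PreHomRel p p' → PreHomRel p.inv p'.inv
  | assoc {W X Y Z : I} (p : PreHom I W X) (q : PreHom I X Y) (r : PreHom I Y Z) :
      PreHomRel ((p.comp q).comp r) (p.comp (q.comp r))
  | id_comp {X Y : I} (p : PreHom I X Y) : PreHomRel ((PreHom.of (𝟙 X)).comp p) p
  | comp_id {X Y : I} (p : PreHom I X Y) : PreHomRel (p.comp (PreHom.of (𝟙 Y))) p
  | of_comp {X Y Z : I} (f : X ⟶ Y) (g : Y ⟶ Z) :
      PreHomRel (PreHom.of (f ≫ g)) ((PreHom.of f).comp (PreHom.of g))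
  | inv_inv {X Y : I} (p : PreHom I X Y) : PreHomRel p.inv.inv p
  | comp_inv_comp {X Y : I} (p : PreHom I X Y) : PreHomRel (p.comp (p.inv.comp p)) p
  | idem_comm {X Y Z : I} (p : PreHom I X Y) (q : PreHom I X Z) :
      PreHomRel ((p.comp p.inv).comp (q.comp q.inv)) ((q.comp q.inv).comp (p.comp p.inv))
  | monic {X Y : I} (f : X ⟶ Y) :
      PreHomRel ((PreHom.of f).comp (PreHom.of f).inv) (PreHom.of (𝟙 X))

instance preHomSetoid (X Y : I) : Setoid (PreHom I X Y) where
  r := PreHomRel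
  iseqv := ⟨PreHomRel.refl, PreHomRel.symm, PreHomRel.trans⟩

variable (I) in
/-- The left fundamental inverse category `L(I)`: the inverse category freely generated by `I` such
that every morphism of `I` becomes monic. It has the same objects as `I`. -/
structure LeftFundamental where
  /-- The corresponding object of `I`. -/
  as : I

instance : Category.{max u v} (LeftFundamental I) where
  Hom X Y := Quotient (preHomSetoid X.as Y.as)
  id X := Quotient.mk _ (PreHom.of (𝟙 X.as))
  comp f g := Quotient.map₂ PreHom.comp (fun _ _ h _ _ h' => PreHomRel.comp_congr h h') f g
  id_comp f := Quotient.inductionOn f fun p => Quotient.sound (PreHomRel.id_comp p)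
  comp_id f := Quotient.inductionOn f fun p => Quotient.sound (PreHomRel.comp_id p)
  assoc f g h := Quotient.inductionOn₃ f g h fun p q r => Quotient.sound (PreHomRel.assoc p q r)

namespace LeftFundamental

/-- The morphism of `L(I)` represented by a formal composite. -/
def homMk {X Y : I} (p : PreHom I X Y) : (⟨X⟩ : LeftFundamental I) ⟶ ⟨Y⟩ := Quotient.mk _ p

variable (I) in
/-- The canonical functor `η : I ⥤ L(I)`. -/
def eta : I ⥤ LeftFundamental I where
  obj X := ⟨X⟩
  map f := homMk (PreHom.of f)
  map_id _ := rfl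
  map_comp f g := Quotient.sound (PreHomRel.of_comp f g)

theorem homMk_surjective {X Y : LeftFundamental I} (f : X ⟶ Y) :
    ∃ p : PreHom I X.as Y.as, homMk p = f := Quotient.exists_rep f

theorem homMk_comp {X Y Z : I} (p : PreHom I X Y) (q : PreHom I Y Z) :
    homMk (p.comp q) = homMk p ≫ homMk q := rfl

theorem homMk_isPseudoinverse {X Y : I} (p : PreHom I X Y) :
    IsPseudoinverse (homMk p) (homMk p.inv) := by
  constructor
  · exact Quotient.sound (PreHomRel.comp_inv_comp p)
  · refine Quotient.sound (PreHomRel.trans ?_ (PreHomRel.comp_inv_comp p.inv))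
    exact PreHomRel.comp_congr (PreHomRel.refl _)
      (PreHomRel.comp_congr (PreHomRel.symm (PreHomRel.inv_inv p)) (PreHomRel.refl _))

theorem homMk_idem_comm {X Y Z : I} (p : PreHom I X Y) (q : PreHom I X Z) :
    (homMk p ≫ homMk p.inv) ≫ (homMk q ≫ homMk q.inv) =
      (homMk q ≫ homMk q.inv) ≫ (homMk p ≫ homMk p.inv) :=
  Quotient.sound (PreHomRel.idem_comm p q)

theorem homMk_inv_inv {X Y : I} (p : PreHom I X Y) : homMk p.inv.inv = homMk p :=
  Quotient.sound (PreHomRel.inv_inv p)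

theorem homMk_eq_of_idem {X : I} (p : PreHom I X X) (hp : homMk p ≫ homMk p = homMk p) :
    homMk p = homMk p ≫ homMk p.inv := by
  obtain ⟨h1, h2⟩ := homMk_isPseudoinverse p
  have hc := homMk_idem_comm p p.inv
  rw [homMk_inv_inv] at hc
  have hp' : ∀ {Z : LeftFundamental I} (k : ⟨X⟩ ⟶ Z),
      homMk p ≫ homMk p ≫ k = homMk p ≫ k := fun k => by rw [← Category.assoc, hp]
  have h3 : homMk p.inv = (homMk p ≫ homMk p.inv) ≫ (homMk p.inv ≫ homMk p) := by
    rw [hc]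
    simp only [Category.assoc, hp', h2]
  have h4 : homMk p = homMk p.inv := by
    calc homMk p = homMk p ≫ homMk p.inv ≫ homMk p := h1.symm
      _ = homMk p ≫ ((homMk p ≫ homMk p.inv) ≫ (homMk p.inv ≫ homMk p)) ≫ homMk p := by
          rw [← h3]
      _ = (homMk p ≫ homMk p.inv) ≫ (homMk p.inv ≫ homMk p) := by
          simp only [Category.assoc, hp', hp]
      _ = homMk p.inv := h3.symm
  rw [← h4, hp]

variable (I) in
/-- `L(I)` is an inverse category. -/
theorem isInverseCategory : IsInverseCategory (LeftFundamental I) := by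
  refine isInverseCategory_of_idem_comm (fun X Y f => ?_) (fun X a b ha hb => ?_)
  · obtain ⟨p, rfl⟩ := homMk_surjective f
    exact ⟨homMk p.inv, homMk_isPseudoinverse p⟩
  · obtain ⟨p, rfl⟩ := homMk_surjective a
    obtain ⟨q, rfl⟩ := homMk_surjective b
    rw [homMk_eq_of_idem p ha, homMk_eq_of_idem q hb, homMk_idem_comm]

variable (I) in
/-- In `L(I)`, every arrow `i` of `I` satisfies `i⁻¹ ∘ i = 1`. -/
theorem eta_monic {X Y : I} (f : X ⟶ Y) :
    (eta I).map f ≫ (isInverseCategory I).pinv ((eta I).map f) = 𝟙 ((eta I).obj X) := by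
  have h : (isInverseCategory I).pinv ((eta I).map f) = homMk (PreHom.of f).inv :=
    (isInverseCategory I _ _ _).unique ((isInverseCategory I).pinv_spec _)
      (homMk_isPseudoinverse _)
  rw [h]
  exact Quotient.sound (PreHomRel.monic f)

section Lift

variable {C : Type u₁} [Category.{v₁} C] (hC : IsInverseCategory C) (F : I ⥤ C)

/-- The value of a formal composite in an inverse category. -/
noncomputable def eval : ∀ {X Y : I}, PreHom I X Y → (F.obj X ⟶ F.obj Y)
  | _, _, .of f => F.map f
  | _, _, .comp p q => eval p ≫ eval q
  | _, _, .inv p => hC.pinv (eval p)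

theorem eval_rel (hF : ∀ {X Y : I} (f : X ⟶ Y), F.map f ≫ hC.pinv (F.map f) = 𝟙 (F.obj X))
    {X Y : I} {p q : PreHom I X Y} (h : PreHomRel p q) : eval hC F p = eval hC F q := by
  have idem : ∀ {A B : C} (a : A ⟶ B), (a ≫ hC.pinv a) ≫ (a ≫ hC.pinv a) = a ≫ hC.pinv a :=
    fun a => by rw [Category.assoc, (hC.pinv_spec a).2]
  induction h with
  | refl => rfl
  | symm _ ih => exact ih.symm
  | trans _ _ ih ih' => exact ih.trans ih'
  | comp_congr _ _ ih ih' => simp only [eval, ih, ih']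
  | inv_congr _ ih => simp only [eval, ih]
  | assoc => simp [eval]
  | id_comp => simp [eval]
  | comp_id => simp [eval]
  | of_comp => simp [eval]
  | inv_inv p => exact (hC _ _ _).unique (hC.pinv_spec _) (hC.pinv_spec _).symm
  | comp_inv_comp p => exact (hC.pinv_spec _).1
  | idem_comm p q => exact hC.idem_comm (idem _) (idem _)
  | monic f => simp only [eval, hF, F.map_id]

/-- The extension to `L(I)` of a functor to an inverse category. -/
noncomputable def lift
    (hF : ∀ {X Y : I} (f : X ⟶ Y), F.map f ≫ hC.pinv (F.map f) = 𝟙 (F.obj X)) :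
    LeftFundamental I ⥤ C where
  obj X := F.obj X.as
  map f := Quotient.lift (eval hC F) (fun _ _ h => eval_rel hC F hF h) f
  map_id X := F.map_id X.as
  map_comp f g := Quotient.inductionOn₂ f g fun _ _ => rfl

/-- The universal property of `L(I)`: every functor `F` from `I` to an inverse category with
`F(i)⁻¹ ∘ F(i) = 1` for all arrows `i` factors uniquely through `η`. -/
theorem existsUnique_lift
    (hF : ∀ {X Y : I} (f : X ⟶ Y), F.map f ≫ hC.pinv (F.map f) = 𝟙 (F.obj X)) :
    ∃! G : LeftFundamental I ⥤ C, eta I ⋙ G = F := by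
  refine ⟨lift hC F hF, rfl, ?_⟩
  rintro G rfl
  refine CategoryTheory.Functor.hext (fun X => rfl) ?_
  rintro ⟨X⟩ ⟨Y⟩ f
  obtain ⟨(p : PreHom I X Y), rfl⟩ := homMk_surjective f
  refine heq_of_eq ?_
  change G.map (homMk p) = eval hC (eta I ⋙ G) p
  induction p with
  | of f => rfl
  | comp p q ihp ihq => rw [homMk_comp, G.map_comp, ihp, ihq]; rfl
  | inv p ih =>
    refine (hC _ _ (G.map (homMk p))).unique ?_ ?_
    · obtain ⟨h1, h2⟩ := homMk_isPseudoinverse p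
      constructor
      · rw [← G.map_comp, ← G.map_comp, h1]
      · rw [← G.map_comp, ← G.map_comp, h2]
    · rw [ih]
      exact hC.pinv_spec _

end Lift

end LeftFundamental

variable (I) in
/-- `I` is upward-simply-connected: every endomorphism in `L(I)` is idempotent. -/
def IsUpwardSimplyConnected : Prop :=
  IsIdempotentCategory (LeftFundamental I)

end LeftFundamental

/-! ### Tree-like and forest-like posets -/

section TreeLike

variable {n : ℕ} (K : Fin n → Type u) [∀ k, PartialOrder (K k)] (U : ∀ k, UpperSet (K k))

/-- The disjoint union of the posets `K k`, together with one more point `bot`. -/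
inductive AdjoinPoint (U : ∀ k, UpperSet (K k)) : Type u
  | bot : AdjoinPoint U
  | incl (k : Fin n) (x : K k) : AdjoinPoint U

variable {K}

/-- The order on the disjoint union of the `K k` with one point adjoined that lies below the
elements of each `U k` (and below no other element of the `K k`). -/
inductive AdjoinPoint.Le : AdjoinPoint K U → AdjoinPoint K U → Prop
  | bot_bot : Le .bot .bot
  | bot_incl (k : Fin n) (x : K k) : x ∈ U k → Le .bot (.incl k x)
  | incl_incl (k : Fin n) (x y : K k) : x ≤ y → Le (.incl k x) (.incl k y)

instance : PartialOrder (AdjoinPoint K U) where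
  le := AdjoinPoint.Le U
  le_refl
    | .bot => .bot_bot
    | .incl k x => .incl_incl k x x le_rfl
  le_trans a b c hab hbc := by
    cases hab with
    | bot_bot => exact hbc
    | bot_incl k x hx =>
      cases hbc with
      | incl_incl _ _ y hxy => exact .bot_incl k y ((U k).upper hxy hx)
    | incl_incl k x y hxy =>
      cases hbc with
      | incl_incl _ _ z hyz => exact .incl_incl k x z (hxy.trans hyz)
  le_antisymm a b hab hba := by
    cases hab with
    | bot_bot => rfl
    | bot_incl k x hx => cases hba
    | incl_incl k x y hxy =>
      cases hba with
      | incl_incl _ _ _ hyx => rw [le_antisymm hxy hyx]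

/-- Finite tree-like posets: the class of posets (closed under isomorphism) generated by the rule
that, if `K₁, …, Kₙ` are tree-like and `Uₖ ⊆ Kₖ` are connected upward-closed subsets, then the
disjoint union of the `Kₖ` with a single point adjoined below each `Uₖ` is tree-like.
Connected posets are nonempty. -/
inductive IsTreeLike : ∀ (P : Type u) [PartialOrder P], Prop
  | mk {P : Type u} [PartialOrder P] {n : ℕ} (K : Fin n → Type u) [∀ k, PartialOrder (K k)]
      (U : ∀ k, UpperSet (K k)) (hK : ∀ k, IsTreeLike (K k))
      (hU : ∀ k, CategoryTheory.IsConnected (U k : Set (K k))) (e : P ≃o AdjoinPoint K U) : IsTreeLike P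

/-- Finite forest-like posets: finite disjoint unions of tree-like posets. -/
def IsForestLike (P : Type u) [PartialOrder P] : Prop :=
  ∃ (n : ℕ) (K : Fin n → Type u) (_ : ∀ k, PartialOrder (K k)),
    (∀ k, IsTreeLike (K k)) ∧ Nonempty (P ≃o Σ k, K k)

end TreeLike

end AmalgamableShapes

open AmalgamableShapes

/-! An arrow of `L(I)` acts on every diagram F of injections as a partial injection, and two
elements of F(X) become equal in the colimit of sets only if an endomorphism in `L(I)` carries one
to the other. An idempotent partial injection is a partial identity, so (iii) makes the maps to the
colimit injective, which gives (ii). Conversely, `I` acts injectively on the arrows of `L(I)` by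
postcomposition, and an injective cocone over this regular representation forces endomorphisms to be
idempotent (`isUpwardSimplyConnected_of_injective`). Finite generation makes the representation
countable, so it also embeds into a diagram in `NatInj`, a category with the AP and the JEP; this
gives (i) → (iii).

For (iii) → (i), identify morphisms of C that become equal after some further morphism. The AP and
the JEP survive, all morphisms become monic, and cocones lift back because only finitely many
generators need correcting. Once morphisms are monic, (ii) applied to the sets of arrows into F(X)
shows that parallel arrows have equal images, so only the poset reflection of `I` matters. It
inherits (ii), hence its upper sets are simply-connected, by the regular representation of their
fundamental groupoids. Such a poset is forest-like: after removing a minimal point b of a connected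
piece, b must lie below a connected part of each remaining component, since otherwise there is
nontrivial monodromy. Cocones are glued along each tree with the AP and across trees with the JEP. A
connected shape gives a single tree, so the AP suffices; connectedness is necessary because discrete
categories have the AP. -/

namespace AmalgamableShapes

/-! ### Basic facts on sets and injections -/

section InjBasics

/-- The function underlying a morphism of `Inj`. -/
def Inj.fn {X Y : Inj.{w}} (f : X ⟶ Y) : X.carrier → Y.carrier :=
  (show X.carrier ↪ Y.carrier from f)

/-- The morphism of `Inj` given by an injective function. -/
def Inj.ofFn {X Y : Inj.{w}} (f : X.carrier → Y.carrier) (hf : Function.Injective f) : X ⟶ Y :=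
  (⟨f, hf⟩ : X.carrier ↪ Y.carrier)

theorem Inj.fn_injective {X Y : Inj.{w}} (f : X ⟶ Y) : Function.Injective (Inj.fn f) :=
  (show X.carrier ↪ Y.carrier from f).injective

@[simp]
theorem Inj.fn_comp {X Y Z : Inj.{w}} (f : X ⟶ Y) (g : Y ⟶ Z) (x : X.carrier) :
    Inj.fn (f ≫ g) x = Inj.fn g (Inj.fn f x) := rfl

@[simp]
theorem Inj.fn_id (X : Inj.{w}) (x : X.carrier) : Inj.fn (𝟙 X) x = x := rfl

theorem Inj.hom_ext {X Y : Inj.{w}} {f g : X ⟶ Y} (h : ∀ x, Inj.fn f x = Inj.fn g x) : f = g :=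
  Function.Embedding.ext (f := f) (g := g) h

variable {I : Type u} [Category.{v} I]

theorem Inj.nonempty_cocone_iff (F : I ⥤ Inj.{w}) :
    Nonempty (Cocone F) ↔ ∃ (A : Type w) (c : ∀ X, (F.obj X).carrier → A),
      (∀ X, Function.Injective (c X)) ∧
        ∀ (X Y : I) (f : X ⟶ Y) (x), c Y (Inj.fn (F.map f) x) = c X x := by
  constructor
  · rintro ⟨s⟩
    refine ⟨s.pt.carrier, fun X => Inj.fn (s.ι.app X), fun X => Inj.fn_injective _,
      fun X Y f x => ?_⟩
    change Inj.fn (F.map f ≫ s.ι.app Y) x = _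
    rw [s.w]
  · rintro ⟨A, c, hc, hn⟩
    exact ⟨⟨⟨A⟩, ⟨fun X => Inj.ofFn (c X) (hc X), fun X Y f => Inj.hom_ext (hn X Y f)⟩⟩⟩

/-- The functor to `Inj` given by a family of injective functions. -/
def Inj.mkFunctor (S : I → Type w) (m : ∀ {X Y : I}, (X ⟶ Y) → S X → S Y)
    (hm : ∀ {X Y : I} (f : X ⟶ Y), Function.Injective (m f))
    (hid : ∀ (X : I) (x : S X), m (𝟙 X) x = x)
    (hcomp : ∀ {X Y Z : I} (f : X ⟶ Y) (g : Y ⟶ Z) (x : S X), m (f ≫ g) x = m g (m f x)) :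
    I ⥤ Inj.{w} where
  obj X := ⟨S X⟩
  map f := Inj.ofFn (m f) (hm f)
  map_id X := Inj.hom_ext (hid X)
  map_comp f g := Inj.hom_ext (hcomp f g)

/-- An arrow in the category of elements of a diagram of injections. -/
inductive Inj.Step (F : I ⥤ Inj.{w}) :
    (Σ X, (F.obj X).carrier) → (Σ X, (F.obj X).carrier) → Prop
  | mk {X Y : I} (f : X ⟶ Y) (x : (F.obj X).carrier) : Step F ⟨X, x⟩ ⟨Y, Inj.fn (F.map f) x⟩

/-- A cocone over a diagram of injections exists as soon as the canonical maps to the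
colimit of sets are injective. -/
theorem Inj.nonempty_cocone_of_eqvGen [Finite I] (F : I ⥤ Inj.{w})
    (h : ∀ (X : I) (x y : (F.obj X).carrier),
      Relation.EqvGen (Inj.Step F) ⟨X, x⟩ ⟨X, y⟩ → x = y) :
    Nonempty (Cocone F) := by
  rw [Inj.nonempty_cocone_iff]
  refine ⟨Shrink.{w} (Quot (Inj.Step F)), fun X x => equivShrink _ (Quot.mk _ ⟨X, x⟩),
    fun X x y hxy => h X x y (Quot.eqvGen_exact ((equivShrink _).injective hxy)),
    fun X Y f x => ?_⟩
  exact congrArg _ (Quot.sound (Inj.Step.mk f x)).symm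

end InjBasics

/-! ### Idempotence of `L(I)` gives cocones of injections -/

section Action

variable {I : Type u} [Category.{v} I] (F : I ⥤ Inj.{w})

/-- The action of formal composites on a diagram of injections, by partial injections. -/
def PreHom.Act : ∀ {X Y : I}, PreHom I X Y → (F.obj X).carrier → (F.obj Y).carrier → Prop
  | _, _, .of f => fun x y => Inj.fn (F.map f) x = y
  | _, _, .comp p q => fun x z => ∃ y, PreHom.Act p x y ∧ PreHom.Act q y z
  | _, _, .inv p => fun y x => PreHom.Act p x y

variable {F}

/-- Functionality and injectivity are proved together because a formal inverse exchanges them. -/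
theorem PreHom.act_partialInjection {X Y : I} (p : PreHom I X Y) :
    (∀ x y y', p.Act F x y → p.Act F x y' → y = y') ∧
      (∀ x x' y, p.Act F x y → p.Act F x' y → x = x') := by
  induction p with
  | of f =>
    exact ⟨fun x y y' h h' => h.symm.trans h',
      fun x x' y h h' => Inj.fn_injective _ (h.trans h'.symm)⟩
  | comp p q ihp ihq =>
    constructor
    · rintro x y y' ⟨z, h1, h2⟩ ⟨z', h1', h2'⟩
      obtain rfl := ihp.1 _ _ _ h1 h1'
      exact ihq.1 _ _ _ h2 h2'
    · rintro x x' y ⟨z, h1, h2⟩ ⟨z', h1', h2'⟩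
      obtain rfl := ihq.2 _ _ _ h2 h2'
      exact ihp.2 _ _ _ h1 h1'
  | inv p ih => exact ⟨fun x y y' => ih.2 y y' x, fun x x' y => ih.1 y x x'⟩

theorem PreHom.act_functional {X Y : I} (p : PreHom I X Y) {x y y'}
    (h : p.Act F x y) (h' : p.Act F x y') : y = y' :=
  p.act_partialInjection.1 x y y' h h'

theorem PreHom.act_injective {X Y : I} (p : PreHom I X Y) {x x' y}
    (h : p.Act F x y) (h' : p.Act F x' y) : x = x' :=
  p.act_partialInjection.2 x x' y h h'

/-- Sets and partial injections form an inverse category in which the total maps satisfy the `monic`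
relation, so the action descends to `L(I)`. -/
theorem PreHomRel.act_iff {X Y : I} {p q : PreHom I X Y} (h : PreHomRel p q) :
    ∀ x y, p.Act F x y ↔ q.Act F x y := by
  induction h with
  | refl p => exact fun _ _ => Iff.rfl
  | symm _ ih => exact fun x y => (ih x y).symm
  | trans _ _ ih ih' => exact fun x y => (ih x y).trans (ih' x y)
  | comp_congr _ _ ih ih' => intro x y; simp only [PreHom.Act, ih, ih']
  | inv_congr _ ih => intro x y; simp only [PreHom.Act, ih]
  | assoc p q r =>
    intro x y
    constructor
    · rintro ⟨a, ⟨b, h1, h2⟩, h3⟩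
      exact ⟨b, h1, a, h2, h3⟩
    · rintro ⟨b, h1, a, h2, h3⟩
      exact ⟨a, ⟨b, h1, h2⟩, h3⟩
  | id_comp p => intro x y; simp [PreHom.Act]
  | comp_id p => intro x y; simp [PreHom.Act]
  | of_comp f g => intro x y; simp [PreHom.Act]
  | inv_inv p => exact fun _ _ => Iff.rfl
  | comp_inv_comp p =>
    intro x y
    constructor
    · rintro ⟨a, h1, b, h2, h3⟩
      obtain rfl := p.act_injective h1 h2
      exact h3
    · exact fun h => ⟨y, h, x, h, h⟩
  | idem_comm p q =>
    intro x y
    constructor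
    · rintro ⟨a, ⟨b, h1, h2⟩, c, h3, h4⟩
      obtain rfl := p.act_injective h1 h2
      obtain rfl := q.act_injective h3 h4
      exact ⟨_, ⟨c, h3, h4⟩, b, h1, h2⟩
    · rintro ⟨a, ⟨b, h1, h2⟩, c, h3, h4⟩
      obtain rfl := q.act_injective h1 h2
      obtain rfl := p.act_injective h3 h4
      exact ⟨_, ⟨c, h3, h4⟩, b, h1, h2⟩
  | monic f =>
    intro x y
    simp only [PreHom.Act, F.map_id, Inj.fn_id, exists_eq_left']
    exact (Inj.fn_injective _).eq_iff.trans eq_comm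

/-- A zigzag in the category of elements, read as a word in arrows and inverses, is a formal
composite. -/
theorem PreHom.exists_act_of_eqvGen {a b : Σ X, (F.obj X).carrier}
    (h : Relation.EqvGen (Inj.Step F) a b) :
    ∃ p : PreHom I a.1 b.1, p.Act F a.2 b.2 := by
  induction h with
  | rel a b h =>
    obtain ⟨f, x⟩ := h
    exact ⟨.of f, rfl⟩
  | refl a => exact ⟨.of (𝟙 _), by simp [PreHom.Act]⟩
  | symm a b _ ih =>
    obtain ⟨p, hp⟩ := ih
    exact ⟨p.inv, hp⟩
  | trans a b c _ _ ih ih' =>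
    obtain ⟨p, hp⟩ := ih
    obtain ⟨q, hq⟩ := ih'
    exact ⟨p.comp q, _, hp, hq⟩

/-- If p is idempotent and carries x to y, then p also carries y to y, so injectivity of the action
gives x = y. -/
theorem IsUpwardSimplyConnected.everyDiagramHasCocone_inj [Finite I]
    (h : IsUpwardSimplyConnected I) : EveryDiagramHasCocone I Inj.{w} := by
  intro F
  refine Inj.nonempty_cocone_of_eqvGen F ?_
  intro X x y hxy
  obtain ⟨p, hp⟩ := PreHom.exists_act_of_eqvGen hxy
  have hpp : PreHomRel (p.comp p) p :=
    Quotient.exact (h ⟨X⟩ (LeftFundamental.homMk p))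
  obtain ⟨z, hz, hzy⟩ := (hpp.act_iff x y).2 hp
  have hzy' : z = y := p.act_functional hz hp
  exact p.act_injective hp (hzy' ▸ hzy)

end Action

/-! ### Reduction to diagrams of finite sets -/

section FiniteSets

variable {I : Type u} [Category.{v} I]

/-- A zigzag identifying two elements visits finitely many elements, and each generates a finite
subdiagram because `I` is finite. A cocone over the resulting finite subdiagram already separates
the two. -/
theorem everyDiagramHasCocone_inj_of_finite [Finite I] (hI : ∀ X Y : I, Finite (X ⟶ Y))
    (h : ∀ F : I ⥤ Inj.{w}, (∀ X, Finite (F.obj X).carrier) → Nonempty (Cocone F)) :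
    EveryDiagramHasCocone I Inj.{w} := by
  intro F
  let Closed (S : Set (Σ X, (F.obj X).carrier)) : Prop := ∀ a b, Inj.Step F a b → a ∈ S → b ∈ S
  have hgen (a : Σ X, (F.obj X).carrier) : ∃ S, S.Finite ∧ Closed S ∧ a ∈ S := by
    refine ⟨Set.range fun f : Σ Y, (a.1 ⟶ Y) => ⟨f.1, Inj.fn (F.map f.2) a.2⟩,
      Set.finite_range _, ?_, ⟨⟨a.1, 𝟙 _⟩, by simp⟩⟩
    rintro _ _ ⟨g, x⟩ ⟨⟨Y, f⟩, hf⟩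
    obtain ⟨rfl, hf⟩ := Sigma.mk.inj_iff.1 hf
    obtain rfl := eq_of_heq hf
    exact ⟨⟨_, f ≫ g⟩, by simp⟩
  -- The last clause says that a and b are already identified using only steps that start in the
  -- finite closed set S.
  have key {a b : Σ X, (F.obj X).carrier} (hab : Relation.EqvGen (Inj.Step F) a b) :
      ∃ S, S.Finite ∧ Closed S ∧ a ∈ S ∧ b ∈ S ∧
      ∀ (A : Type w) (c : (Σ X, (F.obj X).carrier) → A),
        (∀ s ∈ S, ∀ t, Inj.Step F s t → c s = c t) → c a = c b := by
    induction hab with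
    | rel a b hab =>
      obtain ⟨S, hS, hcl, ha⟩ := hgen a
      exact ⟨S, hS, hcl, ha, hcl _ _ hab ha, fun A c hc => hc a ha b hab⟩
    | refl a =>
      obtain ⟨S, hS, hcl, ha⟩ := hgen a
      exact ⟨S, hS, hcl, ha, ha, fun A c hc => rfl⟩
    | symm a b _ ih =>
      obtain ⟨S, hS, hcl, ha, hb, h⟩ := ih
      exact ⟨S, hS, hcl, hb, ha, fun A c hc => (h A c hc).symm⟩
    | trans a b d _ _ ih ih' =>
      obtain ⟨S, hS, hcl, ha, hb, h⟩ := ih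
      obtain ⟨S', hS', hcl', hb', hd, h'⟩ := ih'
      refine ⟨S ∪ S', hS.union hS', fun s t hst hs => hs.imp (hcl s t hst) (hcl' s t hst),
        Or.inl ha, Or.inr hd, fun A c hc => ?_⟩
      exact (h A c fun s hs => hc s (Or.inl hs)).trans (h' A c fun s hs => hc s (Or.inr hs))
  refine Inj.nonempty_cocone_of_eqvGen F ?_
  intro X x y hxy
  obtain ⟨S, hS, hcl, hx, hy, hc⟩ := key hxy
  let G : I ⥤ Inj.{w} := Inj.mkFunctor (fun Y => {z : (F.obj Y).carrier // ⟨Y, z⟩ ∈ S})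
    (fun f z => ⟨Inj.fn (F.map f) z.1, hcl _ _ ⟨f, z.1⟩ z.2⟩)
    (fun f z z' hz => Subtype.ext (Inj.fn_injective _ (Subtype.ext_iff.1 hz)))
    (fun Y z => by simp) (fun f g z => by simp)
  have hG : ∀ Y, Finite (G.obj Y).carrier := fun Y => by
    have : Finite S := hS
    exact Finite.of_injective (β := S) (fun z => ⟨⟨Y, z.1⟩, z.2⟩) fun z z' hz => by
      have := Subtype.ext_iff.1 hz
      exact Subtype.ext (by simpa using this)
  obtain ⟨A, c, hinj, hnat⟩ := (Inj.nonempty_cocone_iff G).1 (h G hG)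
  classical
  -- Extend the cocone on S to all elements by `none`; only steps starting in S are tested, and
  -- these stay in S.
  have := hc (Option A) (fun s => if hs : s ∈ S then some (c s.1 ⟨s.2, hs⟩) else none) (by
    rintro _ hs _ ⟨f, z⟩
    rw [dif_pos hs, dif_pos (hcl _ _ ⟨f, z⟩ hs)]
    exact congrArg some (hnat _ _ f ⟨z, hs⟩).symm)
  rw [dif_pos hx, dif_pos hy] at this
  exact Subtype.ext_iff.1 (hinj X (Option.some_injective _ this))

end FiniteSets

/-! ### Finitely generated categories -/

section FinitelyGenerated

theorem exists_countable_closed {α ι : Type*} [Countable ι] (op : ι → α → α → α) {S : Set α}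
    (hS : S.Countable) :
    ∃ T : Set α, T.Countable ∧ S ⊆ T ∧ ∀ i, ∀ a ∈ T, ∀ b ∈ T, op i a b ∈ T := by
  let stage : ℕ → Set α := Nat.rec S fun _ T => T ∪ ⋃ i, Set.image2 (op i) T T
  have hmono : Monotone stage := monotone_nat_of_le_succ fun n => Set.subset_union_left
  refine ⟨⋃ n, stage n, Set.countable_iUnion fun n => ?_, Set.subset_iUnion stage 0, ?_⟩
  · induction n with
    | zero => exact hS
    | succ n ih => exact ih.union (Set.countable_iUnion fun i => ih.image2 ih _)
  · intro i a ha b hb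
    obtain ⟨m, ha⟩ := Set.mem_iUnion.1 ha
    obtain ⟨n, hb⟩ := Set.mem_iUnion.1 hb
    refine Set.mem_iUnion.2 ⟨max m n + 1, Or.inr (Set.mem_iUnion.2 ⟨i, ?_⟩)⟩
    exact Set.mem_image2_of_mem (hmono (le_max_left _ _) ha) (hmono (le_max_right _ _) hb)

variable {I : Type u} [Category.{v} I]

/-- Arrows whose domain is the domain of a generator are closed under composition, hence are all
arrows; apply this to identities. -/
theorem IsFinitelyGenerated.finite (h : IsFinitelyGenerated I) : Finite I := by
  obtain ⟨W, hW, hgen⟩ := h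
  have htop := hgen (fun X Y _ => X ∈ (fun f : Arrow I => f.left) '' W.toSet)
    ⟨fun _ _ hf _ => hf⟩ fun X Y f hf => ⟨Arrow.mk f, hf, rfl⟩
  refine Set.finite_univ_iff.1 ((hW.image fun f : Arrow I => f.left).subset fun X _ => ?_)
  exact of_eq_true (congrFun (congrFun (congrFun htop X) X) (𝟙 X))

theorem IsFinitelyGenerated.countable_arrow (h : IsFinitelyGenerated I) :
    Countable (Arrow I) := by
  classical
  obtain ⟨W, hW, hgen⟩ := h
  -- Composition is made a total operation on arrows; the value `f` on noncomposable pairs is a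
  -- harmless default.
  obtain ⟨T, hT, hWT, hcl⟩ := exists_countable_closed (ι := Unit)
    (fun (_ : Unit) (f g : Arrow I) =>
      if e : f.right = g.left then Arrow.mk (f.hom ≫ eqToHom e ≫ g.hom)
      else f) hW.countable
  have htop := hgen (fun X Y f => Arrow.mk f ∈ T) ⟨fun {X Y Z} f g hf hg => by
    simpa using hcl () _ hf _ hg⟩ fun X Y f hf => hWT hf
  refine Set.countable_univ_iff.1 (hT.mono fun f _ => ?_)
  exact of_eq_true (congrFun (congrFun (congrFun htop f.left) f.right) f.hom)

theorem IsFinitelyGenerated.countable_preHom (h : IsFinitelyGenerated I) :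
    Countable (Σ X Y : I, PreHom I X Y) := by
  classical
  have := h.countable_arrow
  -- The index `true` stands for composition, with default `p`, and `false` for inversion, which
  -- ignores its second argument.
  obtain ⟨T, hT, hST, hcl⟩ := exists_countable_closed (ι := Bool)
    (fun b (p q : Σ X Y : I, PreHom I X Y) => cond b
      (if e : p.2.1 = q.1 then ⟨p.1, q.2.1, p.2.2.comp (cast (by rw [e]) q.2.2)⟩ else p)
      ⟨p.2.1, p.1, p.2.2.inv⟩)
    (Set.countable_range fun f : Arrow I =>
      (⟨f.left, f.right, .of f.hom⟩ : Σ X Y : I, PreHom I X Y))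
  have key {X Y : I} (p : PreHom I X Y) : (⟨X, Y, p⟩ : Σ X Y : I, PreHom I X Y) ∈ T := by
    induction p with
    | of f => exact hST ⟨Arrow.mk f, rfl⟩
    | comp p q ihp ihq => simpa using hcl true _ ihp _ ihq
    | inv p ih => exact hcl false _ ih _ ih
  exact Set.countable_univ_iff.1 (hT.mono fun p _ => key p.2.2)

theorem isFinitelyGenerated_of_finite [Finite I] (h : ∀ X Y : I, Finite (X ⟶ Y)) :
    IsFinitelyGenerated I := by
  refine ⟨⊤, ?_, fun W' _ hW' => top_le_iff.1 hW'⟩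
  have : Finite (Arrow I) := Finite.of_surjective
    (fun f : Σ X Y : I, (X ⟶ Y) => Arrow.mk f.2.2) fun f => ⟨⟨f.left, f.right, f.hom⟩, rfl⟩
  exact Set.toFinite _

end FinitelyGenerated

/-! ### The regular representation of `L(I)` -/

section Regular

variable (I : Type u) [Category.{v} I]

/-- The morphisms of `L(I)` with given codomain. -/
def LeftFundamental.Over (X : I) : Type (max u v) :=
  Σ Z : I, (⟨Z⟩ : LeftFundamental I) ⟶ ⟨X⟩

variable {I}

theorem LeftFundamental.homMk_of_id (X : I) : homMk (.of (𝟙 X)) = 𝟙 (⟨X⟩ : LeftFundamental I) :=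
  rfl

theorem LeftFundamental.homMk_of_comp {X Y Z : I} (f : X ⟶ Y) (g : Y ⟶ Z) :
    homMk (.of (f ≫ g)) = homMk (.of f) ≫ homMk (.of g) :=
  Quotient.sound (PreHomRel.of_comp f g)

theorem LeftFundamental.homMk_of_monic {X Y : I} (f : X ⟶ Y) :
    homMk (.of f) ≫ homMk (PreHom.of f).inv = 𝟙 _ :=
  Quotient.sound (PreHomRel.monic f)

/-- Postcomposition with an arrow of `I`. -/
def LeftFundamental.Over.map {X Y : I} (f : X ⟶ Y) (g : LeftFundamental.Over I X) :
    LeftFundamental.Over I Y :=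
  ⟨g.1, g.2 ≫ homMk (.of f)⟩

theorem LeftFundamental.Over.map_id (X : I) (g : LeftFundamental.Over I X) : g.map (𝟙 X) = g := by
  obtain ⟨Z, g⟩ := g
  simp only [map, homMk_of_id, Category.comp_id]
  rfl

theorem LeftFundamental.Over.map_comp {X Y Z : I} (f : X ⟶ Y) (f' : Y ⟶ Z)
    (g : LeftFundamental.Over I X) : g.map (f ≫ f') = (g.map f).map f' := by
  simp only [map, homMk_of_comp, ← Category.assoc]
  rfl

theorem LeftFundamental.Over.map_injective {X Y : I} (f : X ⟶ Y) :
    Function.Injective (LeftFundamental.Over.map f) := by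
  rintro ⟨Z, g⟩ ⟨Z', g'⟩ h
  obtain ⟨rfl, h⟩ := Sigma.mk.inj_iff.1 h
  have h' := congrArg (· ≫ homMk (PreHom.of f).inv) (eq_of_heq h)
  simp only [Category.assoc, homMk_of_monic, Category.comp_id] at h'
  rw [h']

/-- Compatibility with the arrows of `I` propagates to formal composites wherever these act as
partial injections. Comparing p⁻¹ with its translate by p then forces p to be idempotent. -/
theorem isUpwardSimplyConnected_of_injective {A : Type*}
    (c : ∀ X : I, LeftFundamental.Over I X → A) (hc : ∀ X, Function.Injective (c X))
    (hn : ∀ (X Y : I) (f : X ⟶ Y) (g), c Y (g.map f) = c X g) :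
    IsUpwardSimplyConnected I := by
  open LeftFundamental in
  -- The condition g p p⁻¹ = g says that g lies in the domain of the partial injection given by p.
  have key {X Y : I} (p : PreHom I X Y) : ∀ {Z : I} (g : (⟨Z⟩ : LeftFundamental I) ⟶ ⟨X⟩),
      g ≫ homMk p ≫ homMk p.inv = g → c Y ⟨Z, g ≫ homMk p⟩ = c X ⟨Z, g⟩ := by
    induction p with
    | of f => exact fun g _ => hn _ _ f ⟨_, g⟩
    | @comp X Y W p q ihp ihq =>
      intro Z g hg
      -- By uniqueness of pseudoinverses, it is enough that q⁻¹p⁻¹ is one for pq; this uses that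
      -- p⁻¹p and qq⁻¹ commute.
      have hinv : homMk (p.comp q).inv = homMk q.inv ≫ homMk p.inv := by
        refine (isInverseCategory I _ _ _).unique (homMk_isPseudoinverse (p.comp q)) ?_
        obtain ⟨h1, h2⟩ := homMk_isPseudoinverse p
        obtain ⟨h3, h4⟩ := homMk_isPseudoinverse q
        have hcomm := homMk_idem_comm p.inv q
        rw [homMk_inv_inv] at hcomm
        simp only [Category.assoc] at hcomm
        rw [homMk_comp]
        have hcomm' {V : LeftFundamental I} (k : ⟨Y⟩ ⟶ V) : homMk p.inv ≫ homMk p ≫ homMk q ≫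
            homMk q.inv ≫ k = homMk q ≫ homMk q.inv ≫ homMk p.inv ≫ homMk p ≫ k := by
          simpa using congrArg (· ≫ k) hcomm
        constructor
        · calc _ = homMk p ≫ (homMk q ≫ homMk q.inv ≫ homMk p.inv ≫ homMk p ≫ homMk q) := by
                simp
            _ = (homMk p ≫ homMk p.inv ≫ homMk p) ≫ (homMk q ≫ homMk q.inv ≫ homMk q) := by
                rw [← hcomm']; simp
            _ = _ := by rw [h1, h3]
        · calc _ = homMk q.inv ≫ (homMk p.inv ≫ homMk p ≫ homMk q ≫ homMk q.inv ≫
                  homMk p.inv) := by simp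
            _ = (homMk q.inv ≫ homMk q ≫ homMk q.inv) ≫
                  (homMk p.inv ≫ homMk p ≫ homMk p.inv) := by rw [hcomm']; simp
            _ = _ := by rw [h2, h4]
      obtain ⟨h1, h2⟩ := homMk_isPseudoinverse p
      rw [hinv, homMk_comp] at hg
      simp only [Category.assoc] at hg
      have hp : g ≫ homMk p ≫ homMk p.inv = g := by
        calc _ = (g ≫ homMk p ≫ homMk q ≫ homMk q.inv ≫ homMk p.inv) ≫
                  homMk p ≫ homMk p.inv := by rw [hg]
          _ = g ≫ homMk p ≫ homMk q ≫ homMk q.inv ≫ (homMk p.inv ≫ homMk p ≫ homMk p.inv) := by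
              simp only [Category.assoc]
          _ = g := by rw [h2, hg]
      have hq : (g ≫ homMk p) ≫ homMk q ≫ homMk q.inv = g ≫ homMk p := by
        have hcomm := homMk_idem_comm p.inv q
        rw [homMk_inv_inv] at hcomm
        simp only [Category.assoc] at hcomm
        calc _ = g ≫ (homMk p ≫ homMk p.inv ≫ homMk p) ≫ homMk q ≫ homMk q.inv := by
              rw [h1]; simp
          _ = g ≫ homMk p ≫ (homMk p.inv ≫ homMk p ≫ homMk q ≫ homMk q.inv) := by simp
          _ = (g ≫ homMk p ≫ homMk q ≫ homMk q.inv ≫ homMk p.inv) ≫ homMk p := by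
              rw [hcomm]; simp
          _ = _ := by rw [hg]
      have := ihq _ hq
      rw [Category.assoc] at this
      rw [homMk_comp, this, ihp _ hp]
    | inv p ih =>
      intro Z g hg
      rw [homMk_inv_inv] at hg
      have := ih (g ≫ homMk p.inv) (by
        rw [Category.assoc, (homMk_isPseudoinverse p).2])
      rw [Category.assoc, hg] at this
      exact this.symm
  rintro ⟨X⟩ f
  obtain ⟨p, rfl⟩ := LeftFundamental.homMk_surjective f
  obtain ⟨h1, h2⟩ := LeftFundamental.homMk_isPseudoinverse p
  -- Taking g = p⁻¹ gives p⁻¹p = p⁻¹, whence p = pp⁻¹p = pp⁻¹.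
  have h := hc _ (key p (LeftFundamental.homMk p.inv) h2)
  have h3 : LeftFundamental.homMk p.inv ≫ LeftFundamental.homMk p =
      LeftFundamental.homMk p.inv := eq_of_heq (Sigma.mk.inj_iff.1 h).2
  have h4 : LeftFundamental.homMk p =
      LeftFundamental.homMk p ≫ LeftFundamental.homMk p.inv := by
    conv_lhs => rw [← h1, h3]
  calc LeftFundamental.homMk p ≫ LeftFundamental.homMk p
      = (LeftFundamental.homMk p ≫ LeftFundamental.homMk p.inv) ≫ LeftFundamental.homMk p := by
        rw [← h4]
    _ = LeftFundamental.homMk p := by rw [Category.assoc, h1]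

end Regular

/-! ### Injections of a countably infinite set -/

section NatInj

/-- The category with one object, whose morphisms are the injections of `ℕ` into itself. -/
structure NatInj : Type u₁ where

instance NatInj.category : Category.{v₁} NatInj.{u₁} where
  Hom _ _ := ULift.{v₁} (ℕ ↪ ℕ)
  id _ := ⟨Function.Embedding.refl ℕ⟩
  comp f g := ⟨f.down.trans g.down⟩

/-- The injection given by a morphism of `NatInj`. -/
def NatInj.emb {X Y : NatInj.{u₁}}
    (f : @Quiver.Hom NatInj.{u₁} NatInj.category.{u₁, v₁}.toQuiver X Y) :
    ℕ ↪ ℕ := ULift.down f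

theorem amalgamationProperty_iff {C : Type u₁} [Category.{v₁} C] :
    AmalgamationProperty C ↔ ∀ {X Y Z : C} (f : X ⟶ Y) (g : X ⟶ Z),
      ∃ (A : C) (h : Y ⟶ A) (k : Z ⟶ A), f ≫ h = g ≫ k := by
  constructor
  · intro H X Y Z f g
    obtain ⟨s⟩ := H (span f g)
    exact ⟨s.pt, s.ι.app WalkingSpan.left, s.ι.app WalkingSpan.right,
      (s.w WalkingSpan.Hom.fst).trans (s.w WalkingSpan.Hom.snd).symm⟩
  · intro H F
    obtain ⟨A, h, k, hk⟩ := H (F.map WalkingSpan.Hom.fst) (F.map WalkingSpan.Hom.snd)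
    exact ⟨(Cocone.precompose (diagramIsoSpan F).hom).obj (PushoutCocone.mk h k hk)⟩

theorem jointEmbeddingProperty_iff {C : Type u₁} [Category.{v₁} C] :
    JointEmbeddingProperty C ↔ ∀ (n : ℕ) (X : Fin n → C), ∃ A, ∀ k, Nonempty (X k ⟶ A) := by
  constructor
  · intro H n X
    obtain ⟨s⟩ := H n (Discrete.functor X)
    exact ⟨s.pt, fun k => ⟨s.ι.app ⟨k⟩⟩⟩
  · intro H n F
    obtain ⟨A, h⟩ := H n fun k => F.obj ⟨k⟩
    exact ⟨⟨A, Discrete.natTrans fun k => (h k.as).some⟩⟩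

theorem NatInj.amalgamationProperty :
    @AmalgamationProperty NatInj.{u₁} NatInj.category.{u₁, v₁} := by
  classical
  rw [amalgamationProperty_iff]
  rintro - - - ⟨f⟩ ⟨g⟩
  -- The codomain of f goes to the even numbers by doubling. The range of g must follow it, and the
  -- rest of the codomain of g is moved out of the way to odd numbers.
  let k : ℕ → ℕ := fun n => if h : ∃ m, g m = n then 2 * f h.choose else 2 * n + 1
  have hk (m : ℕ) : k (g m) = 2 * f m := by
    have h : ∃ m', g m' = g m := ⟨m, rfl⟩
    simp only [k, dif_pos h, g.injective h.choose_spec]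
  have hkinj : Function.Injective k := by
    intro a b hab
    by_cases ha : ∃ m, g m = a <;> by_cases hb : ∃ m, g m = b
    · obtain ⟨m, rfl⟩ := ha
      obtain ⟨n, rfl⟩ := hb
      rw [hk, hk] at hab
      rw [f.injective (by omega : f m = f n)]
    · simp only [k, dif_pos ha, dif_neg hb] at hab
      omega
    · simp only [k, dif_neg ha, dif_pos hb] at hab
      omega
    · simp only [k, dif_neg ha, dif_neg hb] at hab
      omega
  refine ⟨⟨⟩, ⟨⟨fun n => 2 * n, fun a b h => by simpa using h⟩⟩, ⟨⟨k, hkinj⟩⟩, ?_⟩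
  exact congrArg ULift.up (Function.Embedding.ext fun m => (hk m).symm)

theorem NatInj.jointEmbeddingProperty :
    @JointEmbeddingProperty NatInj.{u₁} NatInj.category.{u₁, v₁} :=
  jointEmbeddingProperty_iff.2 fun _ _ => ⟨⟨⟩, fun _ => ⟨⟨Function.Embedding.refl ℕ⟩⟩⟩

variable {I : Type u} [Category.{v} I]

/-- If `I` is finitely generated, the regular representation of `L(I)` embeds into a diagram of
injections of `ℕ`. -/
theorem IsFinitelyGenerated.exists_embedding (h : IsFinitelyGenerated I) :
    ∃ (ι : ∀ X : I, LeftFundamental.Over I X → ℕ) (m : ∀ {X Y : I}, (X ⟶ Y) → (ℕ ↪ ℕ)),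
      (∀ X, Function.Injective (ι X)) ∧ (∀ X n, m (𝟙 X) n = n) ∧
      (∀ {X Y Z : I} (f : X ⟶ Y) (g : Y ⟶ Z) n, m (f ≫ g) n = m g (m f n)) ∧
      ∀ {X Y : I} (f : X ⟶ Y) (g), m f (ι X g) = ι Y (g.map f) := by
  have := h.countable_preHom
  have hX (X : I) : Countable (LeftFundamental.Over I X) := by
    refine Function.Surjective.countable
      (f := fun p : {p : Σ X Y : I, PreHom I X Y // p.2.1 = X} =>
        (⟨p.1.1, LeftFundamental.homMk (cast (by rw [p.2]) p.1.2.2)⟩ : LeftFundamental.Over I X)) ?_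
    rintro ⟨Z, g⟩
    obtain ⟨p, rfl⟩ := LeftFundamental.homMk_surjective g
    exact ⟨⟨⟨Z, X, p⟩, rfl⟩, rfl⟩
  have hX' (X : I) : Nonempty (LeftFundamental.Over I X) := ⟨⟨X, 𝟙 _⟩⟩
  -- The factor ℕ makes the set infinite even when there are finitely many arrows, so it is in
  -- bijection with ℕ; arrows of `I` act trivially on this factor.
  have e (X : I) : LeftFundamental.Over I X × ℕ ≃ ℕ :=
    (nonempty_equiv_of_countable (α := LeftFundamental.Over I X × ℕ) (β := ℕ)).some
  refine ⟨fun X g => e X (g, 0),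
    fun {X Y} f => ⟨fun n => e Y ((((e X).symm n).1).map f, ((e X).symm n).2), fun a b hab => ?_⟩,
    fun X g g' hg => by simpa using hg, fun X n => ?_, fun f g n => ?_, fun f g => ?_⟩
  · have := (e Y).injective hab
    simp only [Prod.mk.injEq] at this
    exact (e X).symm.injective (Prod.ext (LeftFundamental.Over.map_injective f this.1) this.2)
  · simp [LeftFundamental.Over.map_id]
  · change e _ _ = e _ (((e _).symm (e _ _)).1.map g, ((e _).symm (e _ _)).2)
    simp [LeftFundamental.Over.map_comp]
  · change e _ _ = _
    simp

theorem IsUpwardSimplyConnected.of_inj (hI : IsFinitelyGenerated I)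
    (h : EveryDiagramHasCocone I Inj.{w}) : IsUpwardSimplyConnected I := by
  obtain ⟨ι, m, hι, hid, hcomp, hm⟩ := hI.exists_embedding
  obtain ⟨A, c, hc, hn⟩ := (Inj.nonempty_cocone_iff _).1 (h (Inj.mkFunctor (fun _ => ULift ℕ)
    (fun f n => ⟨m f n.down⟩)
    (fun f a b hab => ULift.ext _ _ ((m f).injective (congrArg ULift.down hab)))
    (fun X n => ULift.ext _ _ (hid X n.down)) fun f g n => ULift.ext _ _ (hcomp f g n.down)))
  refine isUpwardSimplyConnected_of_injective (fun X g => c X ⟨ι X g⟩)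
    (fun X a b hab => hι X (congrArg ULift.down (hc X hab))) fun X Y f g => ?_
  rw [← hm]
  exact hn X Y f ⟨ι X g⟩

/-- Testing on `NatInj` rather than `Inj` lets the object and morphism universes be arbitrary and
independent. -/
theorem IsUpwardSimplyConnected.of_natInj (hI : IsFinitelyGenerated I)
    (h : @EveryDiagramHasCocone I _ NatInj.{u₁} NatInj.category.{u₁, v₁}) :
    IsUpwardSimplyConnected I := by
  obtain ⟨ι, m, hι, hid, hcomp, hm⟩ := hI.exists_embedding
  let F : @Functor I _ NatInj.{u₁} NatInj.category.{u₁, v₁} :=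
    { obj := fun _ => ⟨⟩
      map := fun f => ⟨m f⟩
      map_id := fun X => congrArg ULift.up (Function.Embedding.ext (hid X))
      map_comp := fun f g => congrArg ULift.up (Function.Embedding.ext (hcomp f g)) }
  obtain ⟨s⟩ := h F
  refine isUpwardSimplyConnected_of_injective (fun X g => NatInj.emb (s.ι.app X) (ι X g))
    (fun X a b hab => hι X ((NatInj.emb _).injective hab)) fun X Y f g => ?_
  rw [← hm, ← s.w f]
  rfl

end NatInj

/-! ### Upward-closed subsets of posets are simply-connected -/

section SimplyConnected

/-- A property of morphisms of a free groupoid holds for all of them if it is stable under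
composition and holds for the images of the arrows of the category and for their inverses. -/
theorem freeGroupoid_induction {C : Type u} [Category.{v} C]
    (W : MorphismProperty (FreeGroupoid C)) [W.IsStableUnderComposition]
    (h1 : ∀ {X Y : C} (f : X ⟶ Y), W (FreeGroupoid.homMk f))
    (h2 : ∀ {X Y : C} (f : X ⟶ Y), W (Groupoid.inv (FreeGroupoid.homMk f)))
    {X Y : FreeGroupoid C} (f : X ⟶ Y) : W f := by
  have key {X Y : C} (p : @Quiver.Path (Quiver.Symmetrify C) (Quiver.symmetrifyQuiver C) X Y) :
      W (X := FreeGroupoid.mk X) (Y := FreeGroupoid.mk Y) (Quot.mk _ (Quot.mk _ p)) := by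
    induction p with
    | nil =>
      have := h1 (𝟙 X)
      rw [show FreeGroupoid.homMk (𝟙 X) = 𝟙 _ from (FreeGroupoid.of C).map_id X] at this
      exact this
    | @cons Y Z q e ih =>
      refine W.comp_mem (Y := @FreeGroupoid.mk C _ Y)
        (Quot.mk _ (Quot.mk _ q) : FreeGroupoid.mk X ⟶ @FreeGroupoid.mk C _ Y)
        (Quot.mk _ (Quot.mk _ (@Quiver.Hom.toPath (Quiver.Symmetrify C)
          (Quiver.symmetrifyQuiver C) Y Z e)) : @FreeGroupoid.mk C _ Y ⟶ @FreeGroupoid.mk C _ Z) ih ?_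
      change @Quiver.Hom C _ Y Z ⊕ @Quiver.Hom C _ Z Y at e
      cases e with
      | inl f => exact h1 f
      | inr f => exact h2 f
  obtain ⟨⟨X⟩⟩ := X
  obtain ⟨⟨Y⟩⟩ := Y
  obtain ⟨⟨p⟩⟩ := f
  exact key p

variable {P : Type u} [PartialOrder P]

/-- The fundamental groupoid of U acts on itself by postcomposition. Since U is upward-closed, this
extends to a diagram on P that is empty off U, and a cocone over it is invariant under the whole
groupoid. -/
theorem isSimplyConnectedCategory_of_inj (h : EveryDiagramHasCocone P Inj.{u})
    {U : Set P} (hU : IsUpperSet U) : IsSimplyConnectedCategory U := by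
  -- The propositional component makes the set empty when x is not in U.
  let S (x : P) : Type u :=
    Σ' h : x ∈ U, Σ z : U, (FreeGroupoid.mk z ⟶ FreeGroupoid.mk (⟨x, h⟩ : U))
  let m {x y : P} (f : x ⟶ y) (s : S x) : S y := ⟨hU (leOfHom f) s.1, s.2.1, s.2.2 ≫
      FreeGroupoid.homMk (homOfLE (leOfHom f))⟩
  obtain ⟨A, c, hc, hn⟩ := (Inj.nonempty_cocone_iff _).1 (h (Inj.mkFunctor S m
    (fun {x y} f => by
      rintro ⟨h, z, g⟩ ⟨h', z', g'⟩ e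
      obtain ⟨-, e⟩ := PSigma.mk.inj_iff.1 e
      obtain ⟨e1, e2⟩ := Sigma.mk.inj_iff.1 (eq_of_heq e)
      dsimp only at e1
      subst e1
      obtain rfl : g = g' := (cancel_mono _).1 (eq_of_heq e2)
      rfl)
    (fun x s => by
      obtain ⟨h, z, g⟩ := s
      refine PSigma.mk.inj_iff.2 ⟨rfl, heq_of_eq (Sigma.mk.inj_iff.2 ⟨rfl, heq_of_eq ?_⟩)⟩
      exact (congrArg (g ≫ ·) ((FreeGroupoid.of U).map_id _)).trans (Category.comp_id g))
    (fun f f' s => by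
      obtain ⟨h, z, g⟩ := s
      refine PSigma.mk.inj_iff.2 ⟨rfl, heq_of_eq (Sigma.mk.inj_iff.2 ⟨rfl, heq_of_eq ?_⟩)⟩
      exact (congrArg (g ≫ ·) ((FreeGroupoid.of U).map_comp (homOfLE _) (homOfLE _))).trans
        (Category.assoc _ _ _).symm)))
  let c' (X : FreeGroupoid U) (z : U) (g : FreeGroupoid.mk z ⟶ X) : A :=
    c X.as.as.1 ⟨X.as.as.2, z, g⟩
  have hn' {x y : U} (f : x ⟶ y) (z : U) (g : FreeGroupoid.mk z ⟶ FreeGroupoid.mk x) :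
      c' _ z (g ≫ FreeGroupoid.homMk f) = c' _ z g :=
    hn x.1 y.1 (homOfLE (leOfHom f)) ⟨x.2, z, g⟩
  let W : MorphismProperty (FreeGroupoid U) := fun X Y f =>
    ∀ (z : U) (g : FreeGroupoid.mk z ⟶ X), c' Y z (g ≫ f) = c' X z g
  have : W.IsStableUnderComposition := ⟨fun f f' hf hf' z g => by
    rw [← Category.assoc, hf', hf]⟩
  have key {X Y : FreeGroupoid U} (f : X ⟶ Y) : W f := by
    refine freeGroupoid_induction W (fun f => hn' f) (fun f z g => ?_) f
    rw [← hn' f, Category.assoc, Groupoid.inv_comp, Category.comp_id]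
  refine fun X Y => ⟨fun f g => ?_⟩
  -- Both f and g have the same image in the cocone as the identity of X, so injectivity at Y
  -- equates them.
  have h1 := (key f X.as.as (𝟙 X)).trans (key g X.as.as (𝟙 X)).symm
  obtain ⟨-, e⟩ := PSigma.mk.inj_iff.1 (hc _ h1)
  have h2 : 𝟙 X ≫ f = 𝟙 X ≫ g := eq_of_heq (Sigma.mk.inj_iff.1 (eq_of_heq e)).2
  rwa [Category.id_comp, Category.id_comp] at h2

/-- A simply-connected category has no nontrivial monodromy with values in `ℤˣ`. -/
theorem IsSimplyConnectedCategory.monodromy {C : Type u} [Category.{v} C]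
    (h : IsSimplyConnectedCategory C) (F : C ⥤ SingleObj ℤˣ) {X Y Z : C} (f : X ⟶ Y) (g : X ⟶ Z)
    (hYZ : Relation.ReflTransGen (fun A B => (∃ a : A ⟶ B, F.map a = (1 : ℤˣ)) ∨
      ∃ a : B ⟶ A, F.map a = (1 : ℤˣ)) Y Z) : F.map f = F.map g := by
  have key : ∃ k : FreeGroupoid.mk Y ⟶ FreeGroupoid.mk Z,
      (FreeGroupoid.lift F).map k = (1 : ℤˣ) := by
    clear g
    induction hYZ with
    | refl => exact ⟨𝟙 _, (FreeGroupoid.lift F).map_id _⟩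
    | tail _ hBD ih =>
      obtain ⟨k, hk⟩ := ih
      obtain ⟨a, ha⟩ | ⟨a, ha⟩ := hBD
      · refine ⟨k ≫ FreeGroupoid.homMk a, ?_⟩
        rw [Functor.map_comp, FreeGroupoid.lift_map_homMk, hk, ha]
        rfl
      · refine ⟨k ≫ Groupoid.inv (FreeGroupoid.homMk a), ?_⟩
        rw [Functor.map_comp, Groupoid.inv_eq_inv, Functor.map_inv, hk, ← Groupoid.inv_eq_inv,
          FreeGroupoid.lift_map_homMk, ha]
        rfl
  obtain ⟨k, hk⟩ := key
  have := congrArg (FreeGroupoid.lift F).map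
    ((h _ _).elim (FreeGroupoid.homMk f ≫ k) (FreeGroupoid.homMk g))
  rw [Functor.map_comp, hk, FreeGroupoid.lift_map_homMk, FreeGroupoid.lift_map_homMk] at this
  exact (one_mul (M := ℤˣ) _).symm.trans this

end SimplyConnected

/-! ### Decomposition of posets with simply-connected upward-closed subsets -/

section Decomposition

variable {P : Type u} [PartialOrder P]

/-- An upward-closed subset of a finite poset is the disjoint union of its connected
components. -/
theorem exists_components [Finite P] {Q : Set P} (hQ : IsUpperSet Q) :
    ∃ (n : ℕ) (K : Fin n → Set P), (∀ k, IsUpperSet (K k)) ∧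
      (∀ k, CategoryTheory.IsConnected (K k)) ∧ (∀ x, x ∈ Q ↔ ∃ k, x ∈ K k) ∧
      ∀ k l x y, x ∈ K k → y ∈ K l → x ≤ y → k = l := by
  let R (x y : P) : Prop := x ∈ Q ∧ y ∈ Q ∧ (x ≤ y ∨ y ≤ x)
  have hsymm {x y : P} (h : Relation.ReflTransGen R x y) : Relation.ReflTransGen R y x := by
    have : Std.Symm R := ⟨fun x y h => ⟨h.2.1, h.1, h.2.2.symm⟩⟩
    exact Std.Symm.symm _ _ h
  let comp (x : Q) : Set P := {y | Relation.ReflTransGen R x y}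
  have hmem (x : Q) {y : P} (hy : y ∈ comp x) : y ∈ Q := by
    rcases Relation.ReflTransGen.cases_tail hy with h | ⟨z, -, h⟩
    · exact h ▸ x.2
    · exact h.2.1
  have hself (x : Q) : x.1 ∈ comp x := Relation.ReflTransGen.refl
  obtain ⟨n, ⟨e⟩⟩ := Finite.exists_equiv_fin (Set.range comp)
  have he (k : Fin n) : ∃ x, (e.symm k).1 = comp x := by
    obtain ⟨x, hx⟩ := (e.symm k).2
    exact ⟨x, hx.symm⟩
  refine ⟨n, fun k => (e.symm k).1, fun k => ?_, fun k => ?_, fun x => ⟨fun hx => ?_, ?_⟩, ?_⟩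
  · obtain ⟨x, hx⟩ := he k
    simp only [hx]
    intro y z hyz hy
    exact Relation.ReflTransGen.tail hy ⟨hmem x hy, hQ hyz (hmem x hy), Or.inl hyz⟩
  · suffices h : ∀ x, CategoryTheory.IsConnected (comp x) by
      obtain ⟨x, hx⟩ := he k
      change CategoryTheory.IsConnected (e.symm k).1
      rw [hx]
      exact h x
    intro x
    have : Nonempty (comp x) := ⟨⟨x, hself x⟩⟩
    refine IsConnected.of_constant_of_preserves_morphisms fun {α} φ hφ => ?_
    have key {y : P} (hy : Relation.ReflTransGen R x y) :
        φ ⟨y, hy⟩ = φ ⟨x, hself x⟩ := by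
      induction hy with
      | refl => rfl
      | tail hy hyz ih =>
        rw [← ih]
        rcases hyz.2.2 with h | h
        · exact (hφ (j₁ := ⟨_, hy⟩) (j₂ := ⟨_, hy.tail hyz⟩) (homOfLE h)).symm
        · exact hφ (j₁ := ⟨_, hy.tail hyz⟩) (j₂ := ⟨_, hy⟩) (homOfLE h)
    exact fun y z => (key y.2).trans (key z.2).symm
  · exact ⟨e ⟨_, ⟨x, hx⟩, rfl⟩, by simpa using hself ⟨x, hx⟩⟩
  · rintro ⟨k, hk⟩
    obtain ⟨y, hy⟩ := he k
    exact hmem y (hy ▸ hk)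
  · intro k l x y hx hy hxy
    obtain ⟨a, ha⟩ := he k
    obtain ⟨b, hb⟩ := he l
    simp only [ha] at hx
    simp only [hb] at hy
    have hab : Relation.ReflTransGen R a b :=
      (hx.tail ⟨hmem a hx, hmem b hy, Or.inl hxy⟩).trans (hsymm hy)
    refine e.symm.injective (Subtype.ext ?_)
    rw [ha, hb]
    exact Set.ext fun z => ⟨fun h => (hsymm hab).trans h, fun h => hab.trans h⟩

/-- Remove a minimal point b and apply induction to the components of what remains, which are
strictly smaller. The part of each component above b is nonempty because S is connected, and
connected because S has no monodromy. -/
theorem isTreeLike_of_isSimplyConnectedCategory [Finite P]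
    (hP : ∀ U : Set P, IsUpperSet U → IsSimplyConnectedCategory U) (S : Set P)
    (hS : IsUpperSet S) (hconn : CategoryTheory.IsConnected S) : IsTreeLike S := by
  classical
  induction S using WellFoundedLT.induction with
  | ind S ih =>
  obtain ⟨b, hb, hmin⟩ := (Set.toFinite S).exists_minimal
    (Set.nonempty_coe_sort.1 hconn.is_nonempty)
  have hmin {x : P} (hx : x ∈ S) (hxb : x ≤ b) : x = b := le_antisymm hxb (hmin hx hxb)
  have hQ : IsUpperSet (S \ {b}) := fun x y hxy hx =>
    ⟨hS hxy hx.1, fun hy => hx.2 (hmin hx.1 (hxy.trans_eq hy))⟩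
  obtain ⟨n, K, hKup, hKconn, hKmem, hKinj⟩ := exists_components hQ
  have hKS (k) : K k ⊆ S := fun x hx => ((hKmem x).2 ⟨k, hx⟩).1
  have hKb {k x} (hx : x ∈ K k) : x ≠ b := ((hKmem x).2 ⟨k, hx⟩).2
  let U (k : Fin n) : UpperSet (K k) := ⟨{x | b ≤ x.1}, fun x y hxy hx => le_trans hx hxy⟩
  have hUne (k) : Nonempty (U k : Set (K k)) := by
    by_contra hne
    have hne (x : P) (hx : x ∈ K k) : ¬ b ≤ x := fun h => hne ⟨⟨⟨x, hx⟩, h⟩⟩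
    obtain ⟨x, hx⟩ := (hKconn k).is_nonempty
    -- If nothing in `K k` were above b, then `K k` would be closed under comparability in S, hence
    -- would contain b.
    refine hKb (induct_on_objects (J := S) {y | y.1 ∈ K k} (j₀ := ⟨x, hKS k hx⟩) hx ?_ ⟨b, hb⟩) rfl
    intro y z f
    have hyz : y.1 ≤ z.1 := leOfHom f
    refine ⟨fun h => hKup k hyz h, fun h => ?_⟩
    have hyb : y.1 ≠ b := fun hyb => hne z.1 h (hyb ▸ hyz)
    obtain ⟨l, hl⟩ := (hKmem y.1).1 ⟨y.2, hyb⟩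
    exact hKinj l k _ _ hl h hyz ▸ hl
  have hUconn (k) : CategoryTheory.IsConnected (U k : Set (K k)) := by
    refine IsConnected.of_constant_of_preserves_morphisms fun {α} φ hφ v w => ?_
    -- A locally constant φ on `U k` that differs at v and w splits `U k`; χ cuts out the piece
    -- where φ takes values other than `φ v`.
    let χ (y : P) : Prop := ∃ (h : y ∈ K k) (h' : b ≤ y), φ ⟨⟨y, h⟩, h'⟩ ≠ φ v
    have hχb : ¬ χ b := fun ⟨h, _⟩ => hKb h rfl
    have hχ {y z : P} (hy : y ∈ S) (hyb : y ≠ b) (hby : b ≤ y) (hyz : y ≤ z) : χ y ↔ χ z := by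
      constructor
      · rintro ⟨h1, h2, h3⟩
        refine ⟨hKup k hyz h1, h2.trans hyz, ?_⟩
        rwa [← hφ (j₁ := ⟨⟨y, h1⟩, h2⟩) (homOfLE hyz)]
      · rintro ⟨h1, h2, h3⟩
        obtain ⟨l, hl⟩ := (hKmem y).1 ⟨hy, hyb⟩
        obtain rfl := hKinj l k _ _ hl h1 hyz
        refine ⟨hl, hby, ?_⟩
        rwa [hφ (j₁ := ⟨⟨y, hl⟩, hby⟩) (j₂ := ⟨⟨z, h1⟩, h2⟩) (homOfLE hyz)]
    -- Arrows from b into the piece χ get the sign -1, all others 1. Functoriality uses that b is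
    -- minimal, that χ fails at b, and that χ is constant along arrows above b other than those
    -- starting at b.
    let F : S ⥤ SingleObj ℤˣ :=
      { obj := fun _ => SingleObj.star _
        map := fun {x y} _ => (if x.1 = b ∧ χ y.1 then -1 else 1 : ℤˣ)
        map_id := fun x => if_neg fun (h : x.1 = b ∧ χ x.1) => hχb (h.1 ▸ h.2)
        map_comp := fun {x y z} f g => by
          change (_ : ℤˣ) = _ * _
          by_cases hx : x.1 = b
          · by_cases hy : y.1 = b
            · simp [hx, hy, hχb]
            · simp [hx, hy, hχ y.2 hy (hx ▸ leOfHom f : b ≤ y.1) (leOfHom g)]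
          · have hy : y.1 ≠ b := fun hy => hx (hmin x.2 (hy ▸ leOfHom f : x.1 ≤ b))
            simp [hx, hy] }
    have hzig := isPreconnected_zigzag v.1 w.1
    -- A zigzag from v to w inside `K k` avoids b, so all its signs are 1; hence b → v and b → w
    -- must carry the same sign.
    have := (hP S hS).monodromy F
      (X := ⟨b, hb⟩) (Y := ⟨v.1.1, hKS k v.1.2⟩) (Z := ⟨w.1.1, hKS k w.1.2⟩)
      (homOfLE v.2) (homOfLE w.2) (by
        refine Relation.ReflTransGen.lift (fun y : K k => (⟨y.1, hKS k y.2⟩ : S)) ?_ v.1 w.1 hzig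
        rintro x y (⟨⟨f⟩⟩ | ⟨⟨f⟩⟩)
        · exact Or.inl ⟨homOfLE (leOfHom f), if_neg fun h => hKb x.2 h.1⟩
        · exact Or.inr ⟨homOfLE (leOfHom f), if_neg fun h => hKb y.2 h.1⟩)
    have hv : ¬ χ v.1.1 := fun ⟨_, _, h⟩ => h rfl
    change (if b = b ∧ χ v.1.1 then -1 else 1 : ℤˣ) = if b = b ∧ χ w.1.1 then -1 else 1 at this
    by_contra hvw
    have hw : χ w.1.1 := ⟨w.1.2, w.2, fun h => hvw h.symm⟩
    rw [if_neg fun h => hv h.2, if_pos ⟨rfl, hw⟩] at this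
    exact absurd this (by decide)
  let g : AdjoinPoint (fun k => K k) U → S
    | .bot => ⟨b, hb⟩
    | .incl k x => ⟨x.1, hKS k x.2⟩
  have hg (x y) : g x ≤ g y ↔ x ≤ y := by
    constructor
    · intro h
      match x, y, h with
      | .bot, .bot, _ => exact .bot_bot
      | .bot, .incl k y, h => exact .bot_incl (U := U) k y (show b ≤ y.1 from h)
      | .incl k x, .bot, h => exact absurd (hmin (hKS k x.2) h) (hKb x.2)
      | .incl k x, .incl l y, h =>
        obtain rfl := hKinj k l _ _ x.2 y.2 h
        exact .incl_incl (U := U) k x y (show x.1 ≤ y.1 from h)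
    · rintro (_ | ⟨k, x, hx⟩ | ⟨k, x, y, hxy⟩)
      · exact le_rfl
      · exact hx
      · exact hxy
  have hgsurj : Function.Surjective g := by
    rintro ⟨x, hx⟩
    by_cases hxb : x = b
    · exact ⟨.bot, Subtype.ext hxb.symm⟩
    · obtain ⟨k, hk⟩ := (hKmem x).1 ⟨hx, hxb⟩
      exact ⟨.incl k ⟨x, hk⟩, rfl⟩
  refine IsTreeLike.mk (fun k => K k) U (fun k => ?_) hUconn
    (RelIso.ofSurjective (OrderEmbedding.ofMapLEIff g hg) hgsurj).symm
  exact ih (K k) ⟨hKS k, fun h => hKb (h hb) rfl⟩ (hKup k) (hKconn k)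

theorem IsTreeLike.of_orderIso {P Q : Type u} [PartialOrder P] [PartialOrder Q] (e : P ≃o Q)
    (h : IsTreeLike Q) : IsTreeLike P := by
  cases h with
  | mk K U hK hU e' => exact .mk K U hK hU (e.trans e')

theorem isForestLike_of_isSimplyConnectedCategory [Finite P]
    (hP : ∀ U : Set P, IsUpperSet U → IsSimplyConnectedCategory U) : IsForestLike P := by
  obtain ⟨n, K, hKup, hKconn, hKmem, hKinj⟩ := exists_components (isUpperSet_univ (α := P))
  refine ⟨n, fun k => K k, fun k => inferInstance, fun k =>
    isTreeLike_of_isSimplyConnectedCategory hP (K k) (hKup k) (hKconn k), ?_⟩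
  let g (x : Σ k, K k) : P := x.2.1
  have hg (x y) : g x ≤ g y ↔ x ≤ y := by
    constructor
    · obtain ⟨k, x⟩ := x
      obtain ⟨l, y⟩ := y
      intro h
      obtain rfl := hKinj k l _ _ x.2 y.2 h
      exact Sigma.mk_le_mk_iff.2 (show x.1 ≤ y.1 from h)
    · rintro ⟨k, x, y, h⟩
      exact h
  have hgsurj : Function.Surjective g := fun x => by
    obtain ⟨k, hk⟩ := (hKmem x).1 trivial
    exact ⟨⟨k, x, hk⟩, rfl⟩
  exact ⟨(RelIso.ofSurjective (OrderEmbedding.ofMapLEIff g hg) hgsurj).symm⟩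

theorem isTreeLike_of_isConnected [Finite P] [CategoryTheory.IsConnected P]
    (hP : ∀ U : Set P, IsUpperSet U → IsSimplyConnectedCategory U) : IsTreeLike P := by
  have : CategoryTheory.IsConnected (Set.univ : Set P) :=
    isConnected_of_equivalent (OrderIso.Set.univ (α := P)).symm.equivalence
  exact .of_orderIso OrderIso.Set.univ.symm
    (isTreeLike_of_isSimplyConnectedCategory hP Set.univ isUpperSet_univ this)

end Decomposition

/-! ### Cocones over tree-like and forest-like diagrams -/

section TreeCocones

variable {C : Type u₁} [Category.{v₁} C]

/-- With the AP, finitely many morphisms with common domain can be amalgamated. -/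
theorem AmalgamationProperty.exists_wide (hC : AmalgamationProperty C) {X : C} :
    ∀ {n : ℕ} (A : Fin n → C) (f : ∀ k, X ⟶ A k),
      ∃ (B : C) (g : X ⟶ B) (h : ∀ k, A k ⟶ B), ∀ k, f k ≫ h k = g
  | 0, _, _ => ⟨X, 𝟙 X, fun k => k.elim0, fun k => k.elim0⟩
  | n + 1, A, f => by
    obtain ⟨B, g, h, hg⟩ := hC.exists_wide (fun k : Fin n => A k.succ) fun k => f k.succ
    obtain ⟨D, i, j, hij⟩ := amalgamationProperty_iff.1 hC (f 0) g
    refine ⟨D, g ≫ j, Fin.cases i fun k => h k ≫ j, Fin.cases hij fun k => ?_⟩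
    simp only [Fin.cases_succ, ← Category.assoc, hg]

/-- If a functor from `J` to a poset is surjective and every inequality lifts, cocones over
diagrams of shape `J` give cocones over diagrams indexed by the poset. -/
theorem EveryDiagramHasCocone.of_surjective {J : Type u} [Category.{v} J] {P : Type w}
    [PartialOrder P] (K : J ⥤ P) (hK : Function.Surjective K.obj)
    (hK' : ∀ {x y : J}, K.obj x ≤ K.obj y → Nonempty (x ⟶ y))
    (h : EveryDiagramHasCocone J C) : EveryDiagramHasCocone P C := by
  intro F
  obtain ⟨s⟩ := h (K ⋙ F)
  choose σ hσ using hK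
  refine ⟨⟨s.pt, ⟨fun p => F.map (homOfLE (hσ p).ge) ≫ s.ι.app (σ p), fun p q f => ?_⟩⟩⟩
  obtain ⟨a⟩ := hK' (x := σ p) (y := σ q) (by rw [hσ, hσ]; exact leOfHom f)
  simp only [Functor.const_obj_obj, Functor.const_obj_map, Category.comp_id]
  rw [← s.w a, ← Category.assoc, ← Category.assoc, Functor.comp_map, ← F.map_comp, ← F.map_comp]
  rfl

theorem EveryDiagramHasCocone.of_orderIso {P : Type u} {Q : Type w} [PartialOrder P]
    [PartialOrder Q] (e : P ≃o Q) (h : EveryDiagramHasCocone P C) : EveryDiagramHasCocone Q C :=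
  h.of_surjective e.monotone.functor e.surjective fun {_ _} hxy => ⟨homOfLE (e.le_iff_le.1 hxy)⟩

/-- By induction each branch has a cocone. Since `U k` is connected, the composite from the bottom
object to the k-th cocone point does not depend on the element of `U k` used, so amalgamating one
morphism per branch suffices. -/
theorem IsTreeLike.everyDiagramHasCocone (hC : AmalgamationProperty C) {P : Type u}
    [PartialOrder P] (h : IsTreeLike P) : EveryDiagramHasCocone P C := by
  induction h with
  | @mk P _ n K _ U hK hU e ih =>
  refine .of_orderIso e.symm fun F => ?_
  have hincl (k : Fin n) : Monotone (AdjoinPoint.incl (U := U) k) :=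
    fun x y hxy => .incl_incl k x y hxy
  have hbot (k : Fin n) (x : (U k : Set (K k))) :
      (AdjoinPoint.bot : AdjoinPoint K U) ≤ .incl k x.1 := .bot_incl k x.1 x.2
  let s (k : Fin n) : Cocone ((hincl k).functor ⋙ F) := (ih k _).some
  let i (k : Fin n) (x : K k) : F.obj (.incl k x) ⟶ (s k).pt := (s k).ι.app x
  have hi {k : Fin n} {x y : K k} (hxy : x ≤ y) : F.map (homOfLE (hincl k hxy)) ≫ i k y = i k x :=
    (s k).w (homOfLE hxy)
  let γ (k : Fin n) (x : (U k : Set (K k))) : F.obj .bot ⟶ (s k).pt :=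
    F.map (homOfLE (hbot k x)) ≫ i k x.1
  have hγ (k) (x y) : γ k x = γ k y := by
    refine constant_of_preserves_morphisms (γ k) (fun x y f => ?_) x y
    simp only [γ]
    rw [← hi (leOfHom f), ← Category.assoc, ← F.map_comp]
    rfl
  let x₀ (k : Fin n) : (U k : Set (K k)) := (hU k).is_nonempty.some
  obtain ⟨A, g, h, hg⟩ := hC.exists_wide (fun k => (s k).pt) fun k => γ k (x₀ k)
  let c : ∀ a : AdjoinPoint K U, F.obj a ⟶ A
    | .bot => g
    | .incl k x => i k x ≫ h k
  have hc {a b : AdjoinPoint K U} (hab : AdjoinPoint.Le U a b) :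
      F.map (homOfLE (show a ≤ b from hab)) ≫ c b = c a := by
    cases hab with
    | bot_bot => exact (congrArg (· ≫ c .bot) (F.map_id _)).trans (Category.id_comp _)
    | bot_incl k x hx =>
      refine (Category.assoc _ _ _).symm.trans ?_
      exact (congrArg (· ≫ h k) (hγ k ⟨x, hx⟩ (x₀ k))).trans (hg k)
    | incl_incl k x y hxy =>
      refine (Category.assoc _ _ _).symm.trans ?_
      exact congrArg (· ≫ h k) (hi hxy)
  exact ⟨⟨A, ⟨c, fun a b f => (hc (leOfHom f)).trans (Category.comp_id _).symm⟩⟩⟩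

theorem IsForestLike.everyDiagramHasCocone (hC : AmalgamationProperty C)
    (hC' : JointEmbeddingProperty C) {P : Type u} [PartialOrder P] (h : IsForestLike P) :
    EveryDiagramHasCocone P C := by
  obtain ⟨n, K, _, hK, ⟨e⟩⟩ := h
  intro F
  have hincl (k : Fin n) : Monotone fun x : K k => e.symm ⟨k, x⟩ :=
    fun x y hxy => e.symm.monotone (Sigma.mk_le_mk_iff.2 hxy)
  let s (k : Fin n) : Cocone ((hincl k).functor ⋙ F) := ((hK k).everyDiagramHasCocone hC _).some
  obtain ⟨A, h⟩ := jointEmbeddingProperty_iff.1 hC' n fun k => (s k).pt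
  let c (a : Σ k, K k) : F.obj (e.symm a) ⟶ A := (s a.1).ι.app a.2 ≫ (h a.1).some
  have hc {a b : Σ k, K k} (hab : a ≤ b) : F.map (homOfLE (e.symm.monotone hab)) ≫ c b = c a := by
    obtain ⟨k, x, y, hxy⟩ := hab
    refine (Category.assoc _ _ _).symm.trans ?_
    exact congrArg (· ≫ (h k).some) ((s k).w (homOfLE hxy))
  refine ⟨⟨A, ⟨fun p => F.map (homOfLE (e.symm_apply_apply p).ge) ≫ c (e p), fun p q f => ?_⟩⟩⟩
  refine Eq.trans ?_ (Category.comp_id _).symm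
  rw [← hc (e.monotone (leOfHom f)), ← Category.assoc, ← Category.assoc, ← F.map_comp,
    ← F.map_comp]
  rfl

end TreeCocones

/-! ### Reduction to categories in which all morphisms are monic -/

section Monic

variable {C : Type u₁} [Category.{v₁} C]

variable (C) in
/-- Two parallel morphisms are related if some further morphism identifies them. -/
def Coequalizable : HomRel C := fun _ Y f g => ∃ (Z : C) (h : Y ⟶ Z), f ≫ h = g ≫ h

/-- The AP enters twice: to push a coequalizing morphism forward along g, and to merge two
coequalizing morphisms for transitivity. -/
theorem AmalgamationProperty.congruence (hC : AmalgamationProperty C) :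
    Congruence (Coequalizable C) where
  comp_left f g g' := by
    rintro ⟨Z, h, hh⟩
    exact ⟨Z, h, by simp [hh]⟩
  comp_right {X Y Z f f'} g := by
    rintro ⟨W, h, hh⟩
    obtain ⟨A, i, j, hij⟩ := amalgamationProperty_iff.1 hC g h
    exact ⟨A, i, by simp only [Category.assoc, hij, reassoc_of% hh]⟩
  equivalence :=
    { refl := fun f => ⟨_, 𝟙 _, rfl⟩
      symm := fun ⟨Z, h, hh⟩ => ⟨Z, h, hh.symm⟩
      trans := by
        rintro f f' f'' ⟨Z, h, hh⟩ ⟨Z', h', hh'⟩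
        obtain ⟨A, i, j, hij⟩ := amalgamationProperty_iff.1 hC h h'
        exact ⟨A, h ≫ i, by rw [reassoc_of% hh, hij, reassoc_of% hh']⟩ }

variable (C) in
/-- The quotient of a category with the AP in which all morphisms become monic. -/
abbrev MonicQuotient := CategoryTheory.Quotient (Coequalizable C)

variable (C) in
/-- The projection to the quotient in which all morphisms become monic. -/
abbrev MonicQuotient.proj : C ⥤ MonicQuotient C := Quotient.functor _

theorem MonicQuotient.proj_map_eq_iff (hC : AmalgamationProperty C) {X Y : C} (f g : X ⟶ Y) :
    (proj C).map f = (proj C).map g ↔ ∃ (Z : C) (h : Y ⟶ Z), f ≫ h = g ≫ h := by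
  have := hC.congruence
  exact Quotient.functor_map_eq_iff _ f g

/-- If k coequalizes gf and hf, then fk coequalizes g and h. -/
theorem MonicQuotient.mono (hC : AmalgamationProperty C) {X Y : MonicQuotient C} (f : X ⟶ Y) :
    Mono f := by
  refine ⟨fun {Z} g h e => ?_⟩
  obtain ⟨f, rfl⟩ := (proj C).map_surjective (X := X.as) (Y := Y.as) f
  obtain ⟨g, rfl⟩ := (proj C).map_surjective (X := Z.as) (Y := X.as) g
  obtain ⟨h, rfl⟩ := (proj C).map_surjective (X := Z.as) (Y := X.as) h
  have e' : (proj C).map (g ≫ f) = (proj C).map (h ≫ f) := by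
    rw [Functor.map_comp, Functor.map_comp]
    exact e
  obtain ⟨W, k, hk⟩ := (proj_map_eq_iff hC _ _).1 e'
  exact (proj_map_eq_iff hC _ _).2 ⟨W, f ≫ k, by simpa using hk⟩

theorem MonicQuotient.amalgamationProperty (hC : AmalgamationProperty C) :
    AmalgamationProperty (MonicQuotient C) := by
  refine amalgamationProperty_iff.2 fun {X Y Z} f g => ?_
  obtain ⟨f, rfl⟩ := (proj C).map_surjective (X := X.as) (Y := Y.as) f
  obtain ⟨g, rfl⟩ := (proj C).map_surjective (X := X.as) (Y := Z.as) g
  obtain ⟨A, h, k, hk⟩ := amalgamationProperty_iff.1 hC f g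
  refine ⟨(proj C).obj A, (proj C).map h, (proj C).map k, ?_⟩
  exact ((proj C).map_comp f h).symm.trans ((congrArg _ hk).trans ((proj C).map_comp g k))

theorem MonicQuotient.jointEmbeddingProperty (hC : JointEmbeddingProperty C) :
    JointEmbeddingProperty (MonicQuotient C) := by
  refine jointEmbeddingProperty_iff.2 fun n X => ?_
  obtain ⟨A, h⟩ := jointEmbeddingProperty_iff.1 hC n fun k => (X k).as
  exact ⟨(proj C).obj A, fun k => ⟨(proj C).map (h k).some⟩⟩

variable {I : Type u} [Category.{v} I]

/-- For finitely generated shapes, cocones lift from the quotient. -/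
theorem MonicQuotient.nonempty_cocone (hC : AmalgamationProperty C) (hI : IsFinitelyGenerated I)
    (F : I ⥤ C) (h : Nonempty (Cocone (F ⋙ proj C))) : Nonempty (Cocone F) := by
  obtain ⟨s⟩ := h
  choose c hc using fun X => (proj C).map_surjective (X := F.obj X) (Y := s.pt.as) (s.ι.app X)
  obtain ⟨W, hW, hgen⟩ := hI
  have key (f : Arrow I) : ∃ (A : C) (g : s.pt.as ⟶ A),
      (F.map f.hom ≫ c f.right) ≫ g = c f.left ≫ g := by
    refine (proj_map_eq_iff hC _ _).1 ?_
    rw [Functor.map_comp, hc, hc]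
    exact s.w f.hom
  choose A g hg using key
  obtain ⟨n, ⟨e⟩⟩ := @Finite.exists_equiv_fin W.toSet hW
  -- Lifted legs are natural along each arrow only after a further morphism; for the finitely many
  -- generators these are amalgamated into a single i.
  obtain ⟨B, i, j, hij⟩ := hC.exists_wide (fun k => A (e.symm k).1) fun k => g (e.symm k).1
  -- Arrows along which the corrected legs are natural are closed under composition.
  have htop := hgen (fun X Y f => F.map f ≫ c Y ≫ i = c X ≫ i) ⟨fun f f' hf hf' => by
    rw [F.map_comp, Category.assoc, hf', hf]⟩ fun X Y f hf => by
      obtain ⟨k, hk⟩ := e.symm.surjective ⟨Arrow.mk f, hf⟩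
      have := hg (e.symm k).1 =≫ j k
      simp only [Category.assoc, hij] at this
      rw [hk] at this
      exact this
  exact ⟨⟨B, ⟨fun X => c X ≫ i, fun X Y f => (of_eq_true
    (congrFun (congrFun (congrFun htop X) Y) f)).trans (Category.comp_id _).symm⟩⟩⟩

/-- If all `I`-shaped diagrams of injections have cocones, `I`-shaped diagrams in categories with
monic morphisms send parallel arrows to the same morphism. -/
theorem map_eq_map_of_inj (h : EveryDiagramHasCocone I Inj.{max u₁ v₁})
    (hmono : ∀ {X Y : C} (f : X ⟶ Y), Mono f) (F : I ⥤ C) {X Y : I} (f g : X ⟶ Y) :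
    F.map f = F.map g := by
  -- The test diagram sends X to the set of all arrows into F(X); monicity makes its maps injective.
  -- The identity of F(X) is sent to both F(f) and F(g), which the cocone therefore identifies.
  obtain ⟨A, c, hc, hn⟩ := (Inj.nonempty_cocone_iff _).1 (h (Inj.mkFunctor
    (fun X => Σ Z : C, Z ⟶ F.obj X) (fun f s => ⟨s.1, s.2 ≫ F.map f⟩)
    (fun f => by
      rintro ⟨Z, a⟩ ⟨Z', b⟩ e
      obtain ⟨e1, e2⟩ := Sigma.mk.inj_iff.1 e
      dsimp only at e1
      subst e1
      have := hmono (F.map f)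
      obtain rfl : a = b := (cancel_mono _).1 (eq_of_heq e2)
      rfl)
    (fun X s => by simp) fun f g s => by simp))
  have e := hc Y ((hn X Y f ⟨_, 𝟙 _⟩).trans (hn X Y g ⟨_, 𝟙 _⟩).symm)
  have e' : 𝟙 _ ≫ F.map f = 𝟙 _ ≫ F.map g := eq_of_heq (Sigma.mk.inj_iff.1 e).2
  simpa using e'

end Monic

/-! ### Reduction to posets -/

section Reflection

variable (I : Type u) [Category.{v} I]

/-- The objects of `I`, preordered by the existence of arrows. -/
structure ObjPreorder where
  /-- The corresponding object of `I`. -/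
  as : I

instance : Preorder (ObjPreorder I) where
  le X Y := Nonempty (X.as ⟶ Y.as)
  le_refl X := ⟨𝟙 X.as⟩
  le_trans _ _ _ := fun ⟨f⟩ ⟨g⟩ => ⟨f ≫ g⟩

/-- The poset reflection of `I`. -/
abbrev PosetReflection : Type u := Antisymmetrization (ObjPreorder I) (· ≤ ·)

/-- The projection to the poset reflection. -/
def PosetReflection.proj : I ⥤ PosetReflection I where
  obj X := toAntisymmetrization (· ≤ ·) ⟨X⟩
  map f := homOfLE (toAntisymmetrization_le_toAntisymmetrization_iff.2 ⟨f⟩)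

theorem PosetReflection.proj_obj_surjective :
    Function.Surjective (PosetReflection.proj I).obj := fun p => by
  induction p using Antisymmetrization.ind with
  | _ X => exact ⟨X.as, rfl⟩

variable {I}

theorem PosetReflection.nonempty_hom {X Y : I}
    (h : (PosetReflection.proj I).obj X ≤ (PosetReflection.proj I).obj Y) : Nonempty (X ⟶ Y) :=
  toAntisymmetrization_le_toAntisymmetrization_iff.1 h

instance [Finite I] : Finite (PosetReflection I) :=
  Finite.of_surjective _ (PosetReflection.proj_obj_surjective I)

instance [CategoryTheory.IsConnected I] : CategoryTheory.IsConnected (PosetReflection I) := by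
  have : Nonempty (PosetReflection I) := Nonempty.map (PosetReflection.proj I).obj inferInstance
  refine IsConnected.of_constant_of_preserves_morphisms fun {α} φ hφ p q => ?_
  obtain ⟨X, rfl⟩ := PosetReflection.proj_obj_surjective I p
  obtain ⟨Y, rfl⟩ := PosetReflection.proj_obj_surjective I q
  exact constant_of_preserves_morphisms (fun X => φ ((PosetReflection.proj I).obj X))
    (fun X Y f => hφ ((PosetReflection.proj I).map f)) X Y

/-- Since parallel arrows have equal images, F descends to the reflection: choose representatives of
the objects, and any arrow between them will do. -/
theorem PosetReflection.nonempty_cocone {C : Type u₁} [Category.{v₁} C] (F : I ⥤ C)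
    (hF : ∀ {X Y : I} (f g : X ⟶ Y), F.map f = F.map g)
    (h : EveryDiagramHasCocone (PosetReflection I) C) : Nonempty (Cocone F) := by
  choose σ hσ using PosetReflection.proj_obj_surjective I
  have hle {p q : PosetReflection I} (f : p ⟶ q) : Nonempty (σ p ⟶ σ q) :=
    nonempty_hom (by rw [hσ, hσ]; exact leOfHom f)
  let G : PosetReflection I ⥤ C :=
    { obj := fun p => F.obj (σ p)
      map := fun f => F.map (hle f).some
      map_id := fun p => by rw [← F.map_id]; exact hF _ _
      map_comp := fun f g => by rw [← F.map_comp]; exact hF _ _ }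
  obtain ⟨s⟩ := h G
  have hX (X : I) : Nonempty (X ⟶ σ ((proj I).obj X)) := nonempty_hom (hσ _).ge
  refine ⟨⟨s.pt, ⟨fun X => F.map (hX X).some ≫ s.ι.app ((proj I).obj X), fun X Y f => ?_⟩⟩⟩
  refine Eq.trans ?_ (Category.comp_id _).symm
  rw [← s.w ((proj I).map f), ← Category.assoc, ← Category.assoc, ← F.map_comp]
  refine congrArg (· ≫ s.ι.app _) ?_
  exact (hF _ _).trans (F.map_comp _ _)

end Reflection

/-! ### The main implications -/

section Main

variable {I : Type u} [Category.{v} I] {C : Type u₁} [Category.{v₁} C]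

/-- Diagrams of injections on the reflection pull back to `I`, and their cocones descend, so the
reflection inherits (ii). -/
theorem IsUpwardSimplyConnected.reflection (hI : IsFinitelyGenerated I)
    (h : IsUpwardSimplyConnected I) (U : Set (PosetReflection I)) (hU : IsUpperSet U) :
    IsSimplyConnectedCategory U := by
  have := hI.finite
  exact isSimplyConnectedCategory_of_inj (EveryDiagramHasCocone.of_surjective
    (PosetReflection.proj I) (PosetReflection.proj_obj_surjective I)
    PosetReflection.nonempty_hom h.everyDiagramHasCocone_inj) hU

theorem IsUpwardSimplyConnected.of_reflection (hI : IsFinitelyGenerated I)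
    (h : IsUpwardSimplyConnected I) (hC : AmalgamationProperty C)
    (hP : EveryDiagramHasCocone (PosetReflection I) (MonicQuotient C)) :
    EveryDiagramHasCocone I C := by
  have := hI.finite
  exact fun F => MonicQuotient.nonempty_cocone hC hI F (PosetReflection.nonempty_cocone _
    (map_eq_map_of_inj h.everyDiagramHasCocone_inj (MonicQuotient.mono hC) _) hP)

theorem IsUpwardSimplyConnected.everyDiagramHasCocone (hI : IsFinitelyGenerated I)
    (h : IsUpwardSimplyConnected I) (hC : AmalgamationProperty C)
    (hC' : JointEmbeddingProperty C) : EveryDiagramHasCocone I C := by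
  have := hI.finite
  exact h.of_reflection hI hC ((isForestLike_of_isSimplyConnectedCategory
    (h.reflection hI)).everyDiagramHasCocone (MonicQuotient.amalgamationProperty hC)
      (MonicQuotient.jointEmbeddingProperty hC'))

theorem IsUpwardSimplyConnected.everyDiagramHasCocone_of_isConnected
    (hI : IsFinitelyGenerated I) [CategoryTheory.IsConnected I]
    (h : IsUpwardSimplyConnected I) (hC : AmalgamationProperty C) :
    EveryDiagramHasCocone I C := by
  have := hI.finite
  exact h.of_reflection hI hC ((isTreeLike_of_isConnected
    (h.reflection hI)).everyDiagramHasCocone (MonicQuotient.amalgamationProperty hC))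

/-- The discrete category on a type, with universes lifted. -/
structure LiftedDiscrete (α : Type) : Type u₁ where
  /-- The corresponding element of the type. -/
  as : α

instance LiftedDiscrete.category (α : Type) : Category.{v₁} (LiftedDiscrete.{u₁} α) where
  Hom a b := ULift.{v₁} (PLift (a.as = b.as))
  id _ := ⟨⟨rfl⟩⟩
  comp f g := ⟨⟨f.1.1.trans g.1.1⟩⟩

theorem LiftedDiscrete.amalgamationProperty (α : Type) :
    @AmalgamationProperty (LiftedDiscrete.{u₁} α) (LiftedDiscrete.category.{u₁, v₁} α) :=
  amalgamationProperty_iff.2 fun {X _ _} f g =>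
    ⟨X, ⟨⟨f.1.1.symm⟩⟩, ⟨⟨g.1.1.symm⟩⟩, rfl⟩

-- Discrete categories have the AP, and a cocone over a diagram in one forces the diagram to be
-- constant. The empty one detects nonemptiness of `I`; the two-point one receives the
-- characteristic function of any union of components.
variable (I) in
theorem isConnected_of_everyDiagramHasCocone
    (h : ∀ (C : Type u₁) [Category.{v₁} C], AmalgamationProperty C → EveryDiagramHasCocone I C) :
    CategoryTheory.IsConnected I := by
  have hne : Nonempty I := by
    by_contra hI
    rw [not_nonempty_iff] at hI
    let F : @Functor I _ (LiftedDiscrete.{u₁} Empty) (LiftedDiscrete.category.{u₁, v₁} Empty) :=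
      { obj := fun X => isEmptyElim X
        map := fun {X} => isEmptyElim X
        map_id := fun X => isEmptyElim X
        map_comp := fun {X} => isEmptyElim X }
    obtain ⟨s⟩ := h _ (LiftedDiscrete.amalgamationProperty _) F
    exact s.pt.as.elim
  refine IsConnected.of_induct (j₀ := hne.some) fun p hp hcl j => ?_
  classical
  let F : @Functor I _ (LiftedDiscrete.{u₁} Bool) (LiftedDiscrete.category.{u₁, v₁} Bool) :=
    { obj := fun X => ⟨decide (X ∈ p)⟩
      map := fun f => ⟨⟨decide_eq_decide.2 (hcl f)⟩⟩
      map_id := fun _ => rfl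
      map_comp := fun _ _ => rfl }
  obtain ⟨s⟩ := h _ (LiftedDiscrete.amalgamationProperty _) F
  have := (s.ι.app hne.some).1.1.trans (s.ι.app j).1.1.symm
  exact (decide_eq_decide.1 this).1 hp

variable (I) in
theorem IsFinitelyGenerated.tfae_of_jointEmbedding (hI : IsFinitelyGenerated I) :
    List.TFAE [
      ∀ (C : Type u₁) [Category.{v₁} C], AmalgamationProperty C → JointEmbeddingProperty C →
        EveryDiagramHasCocone I C,
      EveryDiagramHasCocone I Inj.{w},
      IsUpwardSimplyConnected I] := by
  have := hI.finite
  tfae_have 1 → 3 := fun h =>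
    .of_natInj hI (h _ NatInj.amalgamationProperty NatInj.jointEmbeddingProperty)
  tfae_have 3 → 2 := fun h => h.everyDiagramHasCocone_inj
  tfae_have 2 → 3 := fun h => .of_inj hI h
  tfae_have 3 → 1 := fun h C _ hC hC' => h.everyDiagramHasCocone hI hC hC'
  tfae_finish

variable (I) in
theorem IsFinitelyGenerated.tfae_of_amalgamation (hI : IsFinitelyGenerated I) :
    List.TFAE [
      ∀ (C : Type u₁) [Category.{v₁} C], AmalgamationProperty C → EveryDiagramHasCocone I C,
      CategoryTheory.IsConnected I ∧ EveryDiagramHasCocone I Inj.{w},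
      CategoryTheory.IsConnected I ∧ IsUpwardSimplyConnected I] := by
  have tfae := IsFinitelyGenerated.tfae_of_jointEmbedding.{u, v, u₁, v₁, w} I hI
  tfae_have 1 → 3 := fun h =>
    ⟨isConnected_of_everyDiagramHasCocone I h,
      (tfae.out 0 2).1 fun (C : Type u₁) (_ : Category.{v₁} C) hC _ => h C hC⟩
  tfae_have 2 ↔ 3 := and_congr_right' (tfae.out 1 2)
  tfae_have 3 → 1 := fun h C _ hC =>
    have := h.1
    h.2.everyDiagramHasCocone_of_isConnected hI hC
  tfae_finish

variable {P : Type u} [PartialOrder P]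

theorem poset_tfae_of_jointEmbedding [Finite P] :
    List.TFAE [
      ∀ (C : Type u₁) [Category.{v₁} C], AmalgamationProperty C → JointEmbeddingProperty C →
        EveryDiagramHasCocone P C,
      EveryDiagramHasCocone P Inj.{w},
      IsUpwardSimplyConnected P,
      ∀ U : Set P, IsUpperSet U → IsSimplyConnectedCategory U,
      IsForestLike P] := by
  have tfae := IsFinitelyGenerated.tfae_of_jointEmbedding.{u, u, u₁, v₁, w} P
    (isFinitelyGenerated_of_finite fun _ _ => inferInstance)
  tfae_have 1 ↔ 2 := tfae.out 0 1
  tfae_have 2 ↔ 3 := tfae.out 1 2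
  tfae_have 3 → 4 := fun h _ hU => isSimplyConnectedCategory_of_inj h.everyDiagramHasCocone_inj hU
  tfae_have 4 → 5 := isForestLike_of_isSimplyConnectedCategory
  tfae_have 5 → 1 := fun h C _ hC hC' => h.everyDiagramHasCocone hC hC'
  tfae_finish

end Main

end AmalgamableShapes

open AmalgamableShapes

theorem theorem1p1 :
    (∀ (I : Type u) [Category.{v} I], IsFinitelyGenerated I →
      -- cocones in all categories with AP and JEP; cocones for sets and injections;
      -- upward-simple-connectedness
      List.TFAE [
        ∀ (C : Type u₁) [Category.{v₁} C], AmalgamationProperty C → JointEmbeddingProperty C →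
          EveryDiagramHasCocone I C,
        EveryDiagramHasCocone I Inj.{w},
        IsUpwardSimplyConnected I] ∧
      -- for finite `I`, it suffices to consider diagrams of finite sets and injections
      (Finite I → (∀ X Y : I, Finite (X ⟶ Y)) →
        ((∀ F : I ⥤ Inj.{w}, (∀ X, Finite (F.obj X).carrier) → Nonempty (Cocone F)) ↔
          EveryDiagramHasCocone I Inj.{w})) ∧
      -- the version with the AP alone
      List.TFAE [
        ∀ (C : Type u₁) [Category.{v₁} C], AmalgamationProperty C → EveryDiagramHasCocone I C,
        CategoryTheory.IsConnected I ∧ EveryDiagramHasCocone I Inj.{w},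
        CategoryTheory.IsConnected I ∧ IsUpwardSimplyConnected I]) ∧
    (∀ (P : Type u) [PartialOrder P] [Finite P],
      -- for finite posets, two further equivalent conditions
      List.TFAE [
        ∀ (C : Type u₁) [Category.{v₁} C], AmalgamationProperty C → JointEmbeddingProperty C →
          EveryDiagramHasCocone P C,
        EveryDiagramHasCocone P Inj.{w},
        IsUpwardSimplyConnected P,
        ∀ U : Set P, IsUpperSet U → IsSimplyConnectedCategory U,
        IsForestLike P] ∧
      -- the version with the AP alone
      List.TFAE [
        ∀ (C : Type u₁) [Category.{v₁} C], AmalgamationProperty C → EveryDiagramHasCocone P C,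
        CategoryTheory.IsConnected P ∧ EveryDiagramHasCocone P Inj.{w},
        CategoryTheory.IsConnected P ∧ IsUpwardSimplyConnected P,
        CategoryTheory.IsConnected P ∧ ∀ U : Set P, IsUpperSet U → IsSimplyConnectedCategory U,
        CategoryTheory.IsConnected P ∧ IsForestLike P]) := by
  refine ⟨fun I _ hI => ⟨hI.tfae_of_jointEmbedding, fun _ hhom =>
    ⟨everyDiagramHasCocone_inj_of_finite hhom, fun h F _ => h F⟩, hI.tfae_of_amalgamation⟩,
    fun P _ _ => ⟨poset_tfae_of_jointEmbedding, ?_⟩⟩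
  have poset := poset_tfae_of_jointEmbedding.{u, u₁, v₁, w} (P := P)
  have connected := IsFinitelyGenerated.tfae_of_amalgamation.{u, u, u₁, v₁, w} P
    (isFinitelyGenerated_of_finite fun _ _ => inferInstance)
  tfae_have 1 ↔ 2 := connected.out 0 1
  tfae_have 2 ↔ 3 := connected.out 1 2
  tfae_have 3 ↔ 4 := and_congr_right' (poset.out 2 3)
  tfae_have 4 ↔ 5 := and_congr_right' (poset.out 3 4)
  tfae_finish
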